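/- Let $\mathcal O$ be an oriented matroid on a finite ground set $E$ with underlying matroid $\mathcal M(\mathcal O)$. For a sign vector $X$ put $z(X)=\{e\in E: X_e=0\}$. Two cocircuits $X,Y$ are *comodular* if $z(X),z(Y)$ form a modular pair in $\mathcal M(\mathcal O)$, and *conformal* if no element has opposite nonzero signs in $X$ and $Y$. An *oriented matroid program* $(\mathcal O,g,f)$ consists of an oriented matroid $\mathcal O$ and distinct elements $g,f$ of its ground set, where $g$ is not a loop and $f$ is not a coloop. Its cocircuit graph $G_f$ has as vertices the cocircuits $X$ with $X_g=+$ and as edges the pairs $(X,Y)$ of distinct, conformal, comodular vertices. For such an edge, cocircuit elimination of $g$ between $-X$ and $Y$ yields a unique cocircuit $Z$; the edge is directed $X\to Y$ if $Z_f=+$, directed $Y\to X$ if $Z_f=-$, and undirected if $Z_f=0$. A *directed cycle* is a sequence $P^1,\dots,P^n=P^1$ of vertices with $P^1,\dots,P^{n-1}$ pairwise distinct, in which every $(P^i,P^{i+1})$ is an edge that is either directed $P^i\to P^{i+1}$ or undirected, and not all of these edges are undirected. The program is *Euclidean* if $G_f$ contains no directed cycle. An element $f\in E$ is *in general position* if every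 $A\subseteq E\setminus\{f\}$ with $f\in\operatorname{cl}(A)$ is spanning. For an ordered set $I=[e_1,\dots,e_k]$ of elements of $E$, the *positive lexicographic extension* $\mathcal O[e_1^+,\dots,e_k^+]=\mathcal O\cup p$ is the single-element extension of $\mathcal O$ by a new element $p$, not a coloop, such that for each cocircuit $Y$ of $\mathcal O$ the sign vector $(Y,\sigma(Y))$ is a cocircuit of $\mathcal O\cup p$, where $\sigma(Y)=Y_{e_i}$ for the smallest $i$ with $Y_{e_i}\neq0$, and $\sigma(Y)=0$ if there is no such $i$. **Corollary.** Let $f\in E$ be in general position and let $I=[e_1,\dots,e_k]$, $k\ge1$, be an ordered set of (distinct) independent elements of $E\setminus\{f\}$ such that $$(\mathcal O,e_1,f),\ (\mathcal O/\{e_1\},e_2,f),\ \dots,\ (\mathcal O/\{e_1,\dots,e_{k-1}\},e_k,f)$$ are Euclidean oriented matroid programs. Let $\mathcal O'=\mathcal O\cup p=\mathcal O[e_1^+,\dots,e_k^+]$. Then $(\mathcal O',p,f)$ is a Euclidean oriented matroid program. -/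

import Mathlib

/-- The composition `X ∘ Y` of two sign vectors. -/
def signComp {α : Type*} (X Y : α → SignType) : α → SignType :=
  fun e => if X e = 0 then Y e else X e

/-- The separation set `sep(X, Y)`: the elements where `X` and `Y` have opposite nonzero signs. -/
def signSep {α : Type*} (X Y : α → SignType) : Set α :=
  {e | X e ≠ 0 ∧ X e = -Y e}

/-- An oriented matroid on a finite ground set `E ⊆ α`, given by its covectors. Sign vectors on
`E` are represented by functions on `α` that vanish outside `E`. -/
structure OrientedMatroid (α : Type*) where
  E : Set α
  finite : E.Finite
  covectors : Set (α → SignType)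
  eq_zero_of_notMem : ∀ X ∈ covectors, ∀ e, e ∉ E → X e = 0
  zero_mem : 0 ∈ covectors
  neg_mem : ∀ X ∈ covectors, -X ∈ covectors
  comp_mem : ∀ X ∈ covectors, ∀ Y ∈ covectors, signComp X Y ∈ covectors
  elim : ∀ X ∈ covectors, ∀ Y ∈ covectors, ∀ e ∈ signSep X Y, ∃ Z ∈ covectors,
    Z e = 0 ∧ ∀ f, f ∉ signSep X Y → Z f = signComp X Y f

namespace OrientedMatroid

/-- Independent sets of the underlying matroid: no `e ∈ I` lies in the closure of `I \ {e}`,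
where the closure of `A` is the set of elements at which all covectors vanishing on `A` vanish. -/
def Indep {α : Type*} (O : OrientedMatroid α) (I : Set α) : Prop :=
  I ⊆ O.E ∧ ∀ e ∈ I, ∃ X ∈ O.covectors, X e ≠ 0 ∧ ∀ e' ∈ I, e' ≠ e → X e' = 0

theorem Indep.mono {α : Type*} {O : OrientedMatroid α} {I J : Set α} (hJ : O.Indep J)
    (h : I ⊆ J) : O.Indep I := by
  refine ⟨h.trans hJ.1, fun e he => ?_⟩
  obtain ⟨X, hX, h1, h2⟩ := hJ.2 e (h he)
  exact ⟨X, hX, h1, fun e' he' => h2 e' (h he')⟩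

theorem exchange {α : Type*} {O : OrientedMatroid α} {A : Set α} {e f : α}
    {X Y : α → SignType} (hX : X ∈ O.covectors) (hXA : ∀ a ∈ A, X a = 0) (hXf : X f = 0)
    (hXe : X e ≠ 0) (hY : Y ∈ O.covectors) (hYA : ∀ a ∈ A, Y a = 0) (hYf : Y f ≠ 0) :
    ∃ Z ∈ O.covectors, (∀ a ∈ A, Z a = 0) ∧ Z e = 0 ∧ Z f ≠ 0 := by
  by_cases hYe : Y e = 0
  · exact ⟨Y, hY, hYA, hYe, hYf⟩
  have key : ∃ X' ∈ O.covectors, (∀ a ∈ A, X' a = 0) ∧ X' f = 0 ∧ e ∈ signSep X' Y := by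
    rcases eq_or_ne (X e) (-Y e) with h | h
    · exact ⟨X, hX, hXA, hXf, hXe, h⟩
    · refine ⟨-X, O.neg_mem X hX, fun a ha => by simp [hXA a ha], by simp [hXf], ?_⟩
      simp only [signSep, Set.mem_ofPred_eq, Pi.neg_apply]
      revert h hXe hYe
      generalize X e = x
      generalize Y e = y
      revert x y
      decide
  obtain ⟨X', hX', hA, hf, he⟩ := key
  obtain ⟨Z, hZ, hZe, hZ'⟩ := O.elim X' hX' Y hY e he
  refine ⟨Z, hZ, fun a ha => ?_, hZe, ?_⟩
  · rw [hZ' a (fun h => h.1 (hA a ha))]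
    simp [signComp, hA a ha, hYA a ha]
  · rw [hZ' f (fun h => h.1 hf)]
    simpa [signComp, hf] using hYf

theorem Indep.insert_indep {α : Type*} {O : OrientedMatroid α} {I : Set α} (hI : O.Indep I) {e : α}
    (he : e ∈ O.E) {X : α → SignType} (hX : X ∈ O.covectors) (hXI : ∀ a ∈ I, X a = 0)
    (hXe : X e ≠ 0) : O.Indep (insert e I) := by
  have heI : e ∉ I := fun h => hXe (hXI e h)
  refine ⟨Set.insert_subset he hI.1, ?_⟩
  intro a ha
  rcases Set.mem_insert_iff.1 ha with rfl | ha
  · refine ⟨X, hX, hXe, fun b hb hba => ?_⟩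
    rcases Set.mem_insert_iff.1 hb with rfl | hb
    · exact absurd rfl hba
    · exact hXI b hb
  · obtain ⟨Y, hY, hYa, hY'⟩ := hI.2 a ha
    obtain ⟨Z, hZ, hZA, hZe, hZa⟩ := exchange (A := I \ {a}) (e := e) (f := a) hX
      (fun b hb => hXI b hb.1) (hXI a ha) hXe hY (fun b hb => hY' b hb.1 hb.2) hYa
    refine ⟨Z, hZ, hZa, fun b hb hba => ?_⟩
    rcases Set.mem_insert_iff.1 hb with rfl | hb
    · exact hZe
    · exact hZA b ⟨hb, hba⟩

theorem Indep.ncard_le {α : Type*} {O : OrientedMatroid α} {I : Set α} (hI : O.Indep I) :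
    ∀ (n : ℕ) (J : Set α), (J \ I).ncard = n → O.Indep J →
      (∀ e ∈ J, ∀ X ∈ O.covectors, (∀ a ∈ I, X a = 0) → X e = 0) → J.ncard ≤ I.ncard := by
  have hIf : I.Finite := O.finite.subset hI.1
  intro n
  induction n with
  | zero =>
    intro J hn hJ _
    have hJf : J.Finite := O.finite.subset hJ.1
    rw [Set.ncard_eq_zero (hJf.subset Set.sdiff_subset), Set.sdiff_eq_empty] at hn
    exact Set.ncard_le_ncard hn hIf
  | succ n ih =>
    intro J hn hJ hcl
    have hJf : J.Finite := O.finite.subset hJ.1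
    obtain ⟨e, heJ, heI⟩ : (J \ I).Nonempty := Set.nonempty_of_ncard_ne_zero (by omega)
    obtain ⟨Y, hY, hYe, hY'⟩ := hJ.2 e heJ
    obtain ⟨x, hxI, hYx⟩ : ∃ x ∈ I, Y x ≠ 0 := by
      by_contra! hcon
      exact hYe (hcl e heJ Y hY hcon)
    have hxe : x ≠ e := fun h => heI (h ▸ hxI)
    have hxJ : x ∉ J := fun h => hYx (hY' x h hxe)
    have hJ' : O.Indep (insert x (J \ {e})) :=
      (hJ.mono Set.sdiff_subset).insert_indep (hI.1 hxI) hY (fun a ha => hY' a ha.1 ha.2) hYx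
    have hcard : (insert x (J \ {e})).ncard = J.ncard := Set.ncard_exchange hxJ heJ
    rw [← hcard]
    refine ih _ ?_ hJ' ?_
    · have h1 : insert x (J \ {e}) \ I = (J \ I) \ {e} := by
        ext a
        simp only [Set.mem_sdiff, Set.mem_insert_iff, Set.mem_singleton_iff]
        constructor
        · rintro ⟨rfl | ⟨h, h'⟩, h2⟩
          · exact absurd hxI h2
          · exact ⟨⟨h, h2⟩, h'⟩
        · rintro ⟨⟨h, h2⟩, h'⟩
          exact ⟨Or.inr ⟨h, h'⟩, h2⟩
      rw [h1, Set.ncard_sdiff_singleton_of_mem (show e ∈ J \ I from ⟨heJ, heI⟩), hn]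
      rfl
    · intro a ha X hX hXI
      rcases Set.mem_insert_iff.1 ha with rfl | ha
      · exact hXI a hxI
      · exact hcl a ha.1 X hX hXI

/-- The underlying matroid `M(O)`. -/
noncomputable def toMatroid {α : Type*} (O : OrientedMatroid α) : Matroid α :=
  (IndepMatroid.ofFinite O.finite O.Indep ⟨Set.empty_subset _, by simp⟩
    (fun _ _ hJ h => hJ.mono h)
    (fun I J hI hJ hlt => by
      by_contra! hcon
      refine absurd (hI.ncard_le _ J rfl hJ fun e he X hX hXI => ?_) (not_le.2 hlt)
      by_contra hXe
      exact hcon e he (fun h => hXe (hXI e h)) (hI.insert_indep (hJ.1 he) hX hXI hXe))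
    (fun _ hI => hI.1)).matroid

theorem toMatroid_E {α : Type*} (O : OrientedMatroid α) : O.toMatroid.E = O.E := rfl

theorem toMatroid_indep_iff {α : Type*} (O : OrientedMatroid α) (I : Set α) :
    O.toMatroid.Indep I ↔ O.Indep I := Iff.rfl

/-- The closure operator of the underlying matroid, read off from the covectors. -/
theorem mem_closure_iff {α : Type*} (O : OrientedMatroid α) {A : Set α} (hA : A ⊆ O.E) {e : α}
    (he : e ∈ O.E) : e ∈ O.toMatroid.closure A ↔
      ∀ X ∈ O.covectors, (∀ a ∈ A, X a = 0) → X e = 0 := by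
  obtain ⟨I, hI⟩ := O.toMatroid.exists_isBasis A hA
  have hind : O.Indep I := (O.toMatroid_indep_iff I).1 hI.indep
  have hspan : ∀ a ∈ O.E, a ∈ O.toMatroid.closure I ↔
      ∀ X ∈ O.covectors, (∀ b ∈ I, X b = 0) → X a = 0 := by
    intro a ha
    rw [hI.indep.mem_closure_iff', toMatroid_indep_iff]
    constructor
    · rintro ⟨-, h⟩ X hX hXI
      by_contra hXa
      exact hXa (hXI a (h (hind.insert_indep ha hX hXI hXa)))
    · intro h
      refine ⟨ha, fun hins => ?_⟩
      obtain ⟨X, hX, hXa, hX'⟩ := hins.2 a (Set.mem_insert _ _)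
      by_contra haI
      exact hXa (h X hX fun b hb => hX' b (Set.mem_insert_of_mem _ hb)
        (fun hba => haI (hba ▸ hb)))
  rw [← hI.closure_eq_closure, hspan e he]
  constructor
  · intro h X hX hXA
    exact h X hX fun b hb => hXA b (hI.subset hb)
  · intro h X hX hXI
    refine h X hX fun a ha => ?_
    exact (hspan a (hA ha)).1 (hI.subset_closure ha) X hX hXI

/-- The cocircuits: the nonzero covectors of inclusion-minimal support. -/
def cocircuits {α : Type*} (O : OrientedMatroid α) : Set (α → SignType) :=
  {X | X ∈ O.covectors ∧ X ≠ 0 ∧ ∀ Y ∈ O.covectors, Y ≠ 0 →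
    Function.support Y ⊆ Function.support X → Function.support X ⊆ Function.support Y}

/-- The contraction `O / A`. -/
def contract {α : Type*} (O : OrientedMatroid α) (A : Set α) : OrientedMatroid α where
  E := O.E \ A
  finite := O.finite.subset Set.sdiff_subset
  covectors := {X | X ∈ O.covectors ∧ ∀ a ∈ A, X a = 0}
  eq_zero_of_notMem X hX e he := by
    by_cases h : e ∈ A
    · exact hX.2 e h
    · exact O.eq_zero_of_notMem X hX.1 e fun h' => he ⟨h', h⟩
  zero_mem := ⟨O.zero_mem, fun _ _ => rfl⟩
  neg_mem X hX := ⟨O.neg_mem X hX.1, fun a ha => by simp [hX.2 a ha]⟩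
  comp_mem X hX Y hY := ⟨O.comp_mem X hX.1 Y hY.1, fun a ha => by
    simp [signComp, hX.2 a ha, hY.2 a ha]⟩
  elim X hX Y hY e he := by
    obtain ⟨Z, hZ, hZe, hZ'⟩ := O.elim X hX.1 Y hY.1 e he
    refine ⟨Z, ⟨hZ, fun a ha => ?_⟩, hZe, hZ'⟩
    rw [hZ' a fun h => h.1 (hX.2 a ha)]
    simp [signComp, hX.2 a ha, hY.2 a ha]

/-- `f` is in general position: it lies in the span only of spanning subsets of `E \ {f}`. -/
def InGeneralPosition {α : Type*} (O : OrientedMatroid α) (f : α) : Prop :=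
  f ∈ O.E ∧ ∀ A ⊆ O.E \ {f}, f ∈ O.toMatroid.closure A → O.toMatroid.Spanning A

/-! ### Oriented matroid programs -/

/-- `(O, g, f)` is an oriented matroid program. -/
def IsProgram {α : Type*} (O : OrientedMatroid α) (g f : α) : Prop :=
  g ∈ O.E ∧ f ∈ O.E ∧ g ≠ f ∧ ¬ O.toMatroid.IsLoop g ∧ ¬ O.toMatroid.IsColoop f

/-- The zero set `z(X)`. -/
def zeroSet {α : Type*} (O : OrientedMatroid α) (X : α → SignType) : Set α :=
  {e ∈ O.E | X e = 0}

/-- `X` and `Y` are comodular: their zero sets form a modular pair in the underlying matroid. -/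
def Comodular {α : Type*} (O : OrientedMatroid α) (X Y : α → SignType) : Prop :=
  O.toMatroid.eRk (O.zeroSet X) + O.toMatroid.eRk (O.zeroSet Y) =
    O.toMatroid.eRk (O.zeroSet X ∪ O.zeroSet Y) + O.toMatroid.eRk (O.zeroSet X ∩ O.zeroSet Y)

/-- `Z` is a cocircuit obtained by cocircuit elimination of `e` between `X` and `Y`, i.e.
`Z⁺ ⊆ (X⁺ ∪ Y⁺) \ {e}` and `Z⁻ ⊆ (X⁻ ∪ Y⁻) \ {e}`. -/
def IsElimination {α : Type*} (O : OrientedMatroid α) (e : α) (X Y Z : α → SignType) : Prop :=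
  Z ∈ O.cocircuits ∧ Z e = 0 ∧ ∀ a, Z a ≠ 0 → Z a = X a ∨ Z a = Y a

/-- The vertices of the cocircuit graph `G_f` of `(O, g, f)`. -/
def IsVertex {α : Type*} (O : OrientedMatroid α) (g : α) (X : α → SignType) : Prop :=
  X ∈ O.cocircuits ∧ X g = 1

/-- The edges of the cocircuit graph `G_f` of `(O, g, f)`. -/
def IsEdge {α : Type*} (O : OrientedMatroid α) (g : α) (X Y : α → SignType) : Prop :=
  O.IsVertex g X ∧ O.IsVertex g Y ∧ X ≠ Y ∧ O.Comodular X Y ∧ signSep X Y = ∅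

/-- `X → Y` in `(O, g, f)`: eliminating `g` between `-X` and `Y` yields `Z` with `Z_f = +`. -/
def Directed {α : Type*} (O : OrientedMatroid α) (g f : α) (X Y : α → SignType) : Prop :=
  ∃ Z, O.IsElimination g (-X) Y Z ∧ Z f = 1

/-- `X ↔ Y` in `(O, g, f)`: eliminating `g` between `-X` and `Y` yields `Z` with `Z_f = 0`. -/
def Undirected {α : Type*} (O : OrientedMatroid α) (g f : α) (X Y : α → SignType) : Prop :=
  ∃ Z, O.IsElimination g (-X) Y Z ∧ Z f = 0

/-- `P = [P¹, …, Pⁿ]` is a path in the cocircuit graph. -/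
def IsPath {α : Type*} (O : OrientedMatroid α) (g : α) (P : List (α → SignType)) : Prop :=
  P ≠ [] ∧ (∀ X ∈ P, O.IsVertex g X) ∧ P.IsChain (O.IsEdge g)

/-- A path is undirected if all its edges are undirected. -/
def IsUndirectedPath {α : Type*} (O : OrientedMatroid α) (g f : α)
    (P : List (α → SignType)) : Prop :=
  O.IsPath g P ∧ P.IsChain (O.Undirected g f)

/-- A path is directed if it is not undirected and each of its edges is either directed forward
or undirected. -/
def IsDirectedPath {α : Type*} (O : OrientedMatroid α) (g f : α)
    (P : List (α → SignType)) : Prop :=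
  O.IsPath g P ∧ ¬ O.IsUndirectedPath g f P ∧
    P.IsChain (fun X Y => O.Directed g f X Y ∨ O.Undirected g f X Y)

/-- A closed path whose vertices are distinct, except that the first is the last. -/
def IsCycle {α : Type*} (O : OrientedMatroid α) (g : α) (P : List (α → SignType)) : Prop :=
  O.IsPath g P ∧ P.head? = P.getLast? ∧ P.dropLast.Nodup

/-- `(O, g, f)` is a Euclidean oriented matroid program: it is an oriented matroid program whose
directed cocircuit graph contains no directed cycle. -/
def IsEuclideanProgram {α : Type*} (O : OrientedMatroid α) (g f : α) : Prop :=
  O.IsProgram g f ∧ ¬ ∃ P, O.IsCycle g P ∧ O.IsDirectedPath g f P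

/-! ### Lexicographic extensions -/

/-- The localization of the positive lexicographic extension `O[e₁⁺, …, e_k⁺]`: the first nonzero
sign among `Y_{e₁}, …, Y_{e_k}`, and `0` if there is none. -/
def lexSign {α : Type*} : List α → (α → SignType) → SignType
  | [], _ => 0
  | e :: I, Y => if Y e = 0 then lexSign I Y else Y e

open Classical in
/-- `O' = O ∪ p` is the positive lexicographic extension `O[e₁⁺, …, e_k⁺]`: a single-element
extension of `O` by `p` (deleting `p` from `O'` gives `O`) that is non-trivial (`p` is not a
coloop) and whose localization is `lexSign I`, i.e. `(Y, lexSign I Y)` is a cocircuit of `O'` for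
every cocircuit `Y` of `O`. -/
structure IsPositiveLexExtension {α : Type*} (O : OrientedMatroid α) (I : List α) (p : α)
    (O' : OrientedMatroid α) : Prop where
  notMem : p ∉ O.E
  ground_eq : O'.E = insert p O.E
  deletion_eq : (fun W : α → SignType => Function.update W p 0) '' O'.covectors = O.covectors
  not_isColoop : ¬ O'.toMatroid.IsColoop p
  localization : ∀ Y ∈ O.cocircuits, Function.update Y p (lexSign I Y) ∈ O'.cocircuits

theorem lexSign_neg {α : Type*} (I : List α) (X : α → SignType) :
    lexSign I (-X) = -lexSign I X := by
  induction I with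
  | nil => simp [lexSign]
  | cons a I ih =>
    by_cases h : X a = 0 <;> simp [lexSign, h, ih]

theorem lexSign_eq_zero_iff {α : Type*} (I : List α) (X : α → SignType) :
    lexSign I X = 0 ↔ ∀ e ∈ I, X e = 0 := by
  induction I with
  | nil => simp [lexSign]
  | cons a I ih =>
    by_cases h : X a = 0 <;> simp [lexSign, h, ih]

theorem lexSign_comp {α : Type*} (I : List α) (X Y : α → SignType) (h : lexSign I X = 0) :
    lexSign I (signComp X Y) = lexSign I Y := by
  induction I with
  | nil => rfl
  | cons a I ih =>
    have h0 := (lexSign_eq_zero_iff _ _).1 h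
    have ha : X a = 0 := h0 a (by simp)
    have hI : lexSign I X = 0 :=
      (lexSign_eq_zero_iff _ _).2 fun e he => h0 e (List.mem_cons_of_mem _ he)
    simp [lexSign, signComp, ha]
    by_cases hY : Y a = 0
    · simpa [hY] using ih hI
    · simp [hY]

theorem lexSign_elim {α : Type*} (I : List α) (X Y Z : α → SignType) (s : SignType) (hs : s ≠ 0)
    (hX : lexSign I X = s) (hY : lexSign I Y = 0 ∨ lexSign I Y = s)
    (hZ : ∀ f, f ∉ signSep X Y → Z f = signComp X Y f) : lexSign I Z = s := by
  induction I with
  | nil => exact absurd hX (by simpa [lexSign] using hs.symm)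
  | cons a I ih =>
    have hZa := hZ a
    simp only [signSep, signComp, Set.mem_ofPred_eq] at hZa
    simp only [lexSign] at hX hY ⊢
    by_cases h1 : X a = 0
    · rw [if_pos h1] at hX
      by_cases h2 : Y a = 0
      · rw [if_pos h2] at hY
        rw [if_pos (by simpa [h1, h2] using hZa)]
        exact ih hX hY
      · rw [if_neg h2] at hY
        have : Z a = Y a := by simpa [h1] using hZa
        rw [this, if_neg h2]
        exact hY.resolve_left h2
    · rw [if_neg h1] at hX
      have hsep : ¬ (X a ≠ 0 ∧ X a = -Y a) := by
        by_cases h2 : Y a = 0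
        · rw [h2]
          rintro ⟨h, h'⟩
          exact h (by simpa using h')
        · rw [if_neg h2] at hY
          rw [hX, hY.resolve_left h2]
          clear * - hs
          revert s
          decide
      have : Z a = X a := by simpa [h1] using hZa hsep
      rw [this, if_neg h1, hX]

/-- `Y` conforms to `X`: each nonzero sign of `Y` agrees with that of `X`. -/
def Conf {α : Type*} (Y X : α → SignType) : Prop := ∀ e, Y e ≠ 0 → Y e = X e

theorem Conf.trans {α : Type*} {X Y Z : α → SignType} (h : Conf X Y) (h' : Conf Y Z) :
    Conf X Z := fun e he => by
  have := h e he
  rw [this]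
  exact h' e (this ▸ he)

theorem conf_comp {α : Type*} (X Y : α → SignType) : Conf X (signComp X Y) := fun e he => by
  simp [signComp, he]

theorem Conf.lexSign_eq_zero {α : Type*} {X Y : α → SignType} {I : List α} (h : Conf Y X)
    (hX : lexSign I X = 0) : lexSign I Y = 0 := by
  rw [lexSign_eq_zero_iff] at hX ⊢
  intro e he
  by_contra hY
  exact hY ((h e hY).trans (hX e he))

/-- `(X, s)` is a covector of the positive lexicographic extension. -/
def LexCov {α : Type*} (O : OrientedMatroid α) (I : List α) (X : α → SignType)
    (s : SignType) : Prop :=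
  X ∈ O.covectors ∧ (s = lexSign I X ∨
    ∃ Y ∈ O.covectors, Conf Y X ∧ lexSign I Y ≠ 0 ∧ lexSign I Y = -lexSign I X)

theorem sign_eq_or {s t : SignType} (hs : s ≠ 0) (ht : t ≠ 0) : s = t ∨ s = -t := by
  revert s t
  decide

theorem LexCov.of_conf {α : Type*} {O : OrientedMatroid α} {I : List α} {X Y : α → SignType}
    (hX : X ∈ O.covectors) (hY : Y ∈ O.covectors) (h : Conf Y X) (h0 : lexSign I Y ≠ 0) :
    O.LexCov I X (lexSign I Y) := by
  have hX0 : lexSign I X ≠ 0 := fun h' => h0 (h.lexSign_eq_zero h')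
  rcases sign_eq_or h0 hX0 with h1 | h1
  · exact ⟨hX, Or.inl h1⟩
  · exact ⟨hX, Or.inr ⟨Y, hY, h, h0, h1⟩⟩

theorem LexCov.of_conf_conf {α : Type*} {O : OrientedMatroid α} {I : List α}
    {X Y Y' : α → SignType} (hX : X ∈ O.covectors) (hY : Y ∈ O.covectors) (h : Conf Y X)
    (h0 : lexSign I Y ≠ 0) (hY' : Y' ∈ O.covectors) (h' : Conf Y' X)
    (h0' : lexSign I Y' = -lexSign I Y) (s : SignType) : O.LexCov I X s := by
  refine ⟨hX, Or.inr ?_⟩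
  have hX0 : lexSign I X ≠ 0 := fun h' => h0 (h.lexSign_eq_zero h')
  rcases sign_eq_or h0 hX0 with h1 | h1
  · exact ⟨Y', hY', h', by rw [h0', h1]; simpa using hX0, by rw [h0', h1]⟩
  · exact ⟨Y, hY, h, h0, h1⟩

theorem LexCov.witness {α : Type*} {O : OrientedMatroid α} {I : List α} {X : α → SignType}
    {s : SignType} (h : O.LexCov I X s) (hs : s ≠ 0) :
    ∃ Y ∈ O.covectors, Conf Y X ∧ lexSign I Y = s := by
  obtain ⟨hX, rfl | ⟨Y, hY, hYX, h0, h1⟩⟩ := h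
  · exact ⟨X, hX, fun _ _ => rfl, rfl⟩
  · rcases sign_eq_or hs h0 with h2 | h2
    · exact ⟨Y, hY, hYX, h2.symm⟩
    · exact ⟨X, hX, fun _ _ => rfl, by rw [h2, h1, neg_neg]⟩

theorem LexCov.witness_zero {α : Type*} {O : OrientedMatroid α} {I : List α} {X : α → SignType}
    (h : O.LexCov I X 0) (s : SignType) (hs : s ≠ 0) :
    lexSign I X = 0 ∨ ∃ Y ∈ O.covectors, Conf Y X ∧ lexSign I Y = s := by
  obtain ⟨hX, h | ⟨Y, hY, hYX, h0, h1⟩⟩ := h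
  · exact Or.inl h.symm
  · exact Or.inr (LexCov.witness (s := s) ⟨hX, Or.inr ⟨Y, hY, hYX, h0, h1⟩⟩ hs)

theorem LexCov.neg {α : Type*} {O : OrientedMatroid α} {I : List α} {X : α → SignType}
    {s : SignType} (h : O.LexCov I X s) : O.LexCov I (-X) (-s) := by
  obtain ⟨hX, rfl | ⟨Y, hY, hYX, h0, h1⟩⟩ := h
  · exact ⟨O.neg_mem X hX, Or.inl (lexSign_neg I X).symm⟩
  · refine ⟨O.neg_mem X hX, Or.inr ⟨-Y, O.neg_mem Y hY, fun e he => ?_, ?_, ?_⟩⟩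
    · simp only [Pi.neg_apply] at he ⊢
      rw [hYX e fun h => he (by simp [h])]
    · rw [lexSign_neg]
      simpa using h0
    · rw [lexSign_neg, lexSign_neg, h1]

theorem LexCov.comp {α : Type*} {O : OrientedMatroid α} {I : List α} {X Y : α → SignType}
    {s t : SignType} (h : O.LexCov I X s) (h' : O.LexCov I Y t) :
    O.LexCov I (signComp X Y) (if s = 0 then t else s) := by
  have hXY := O.comp_mem X h.1 Y h'.1
  split_ifs with hs
  · subst hs
    obtain ⟨hX, hX0 | ⟨Z, hZ, hZX, h0, h1⟩⟩ := h
    · have hc := lexSign_comp I X Y hX0.symm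
      obtain ⟨hY, rfl | ⟨Z, hZ, hZY, h0, h1⟩⟩ := h'
      · exact ⟨hXY, Or.inl hc.symm⟩
      · refine ⟨hXY, Or.inr ⟨signComp X Z, O.comp_mem X hX Z hZ, fun e he => ?_, ?_, ?_⟩⟩
        · by_cases hXe : X e = 0
          · simp only [signComp, hXe, if_true] at he ⊢
            exact hZY e he
          · simp [signComp, hXe]
        · rwa [lexSign_comp I X Z hX0.symm]
        · rw [lexSign_comp I X Z hX0.symm, hc, h1]
    · exact LexCov.of_conf_conf hXY hZ (hZX.trans (conf_comp X Y)) h0 hX (conf_comp X Y)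
        (by rw [h1, neg_neg]) t
  · obtain ⟨Z, hZ, hZX, rfl⟩ := h.witness hs
    exact LexCov.of_conf hXY hZ (hZX.trans (conf_comp X Y)) hs

theorem sep_symm {α : Type*} {X Y : α → SignType} {e : α} (h : e ∈ signSep X Y) :
    e ∈ signSep Y X := by
  obtain ⟨h1, h2⟩ := h
  refine ⟨fun h => h1 (by rw [h2, h, neg_zero]), by rw [h2, neg_neg]⟩

theorem comp_symm {α : Type*} {X Y : α → SignType} {e : α} (h : e ∉ signSep X Y) :
    signComp X Y e = signComp Y X e := by
  simp only [signSep, signComp, Set.mem_ofPred_eq] at h ⊢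
  revert h
  generalize X e = x
  generalize Y e = y
  revert x y
  decide

theorem lex_elim_aux {α : Type*} {O : OrientedMatroid α} {I : List α}
    {X₁ X₂ Y₁ Y₂ : α → SignType} {e : α} {s : SignType} (hs : s ≠ 0)
    (he : e ∈ signSep X₁ X₂) (hX₁ : X₁ ∈ O.covectors) (hX₂ : X₂ ∈ O.covectors)
    (hY₁ : Y₁ ∈ O.covectors) (hY₂ : Y₂ ∈ O.covectors) (h₁ : Conf Y₁ X₁) (h₂ : Conf Y₂ X₂)
    (hσ₁ : lexSign I Y₁ = s) (hσ₂ : lexSign I Y₂ = s ∨ Y₂ = X₂ ∧ lexSign I X₂ = 0) :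
    ∃ Z ∈ O.covectors, Z e = 0 ∧ (∀ f, f ∉ signSep X₁ X₂ → Z f = signComp X₁ X₂ f) ∧
      O.LexCov I Z s := by
  have main : ∃ Z ∈ O.covectors, Z e = 0 ∧ lexSign I Z = s ∧
      ∀ f, f ∉ signSep X₁ X₂ → Z f = 0 ∨ Z f = signComp X₁ X₂ f := by
    have c1 : ∀ f, f ∉ signSep X₁ X₂ → Y₁ f = 0 ∨ Y₁ f = signComp X₁ X₂ f := by
      intro f _
      by_cases h : Y₁ f = 0
      · exact Or.inl h
      · exact Or.inr ((h₁.trans (conf_comp X₁ X₂)) f h)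
    have c2 : ∀ f, f ∉ signSep X₁ X₂ → Y₂ f = 0 ∨ Y₂ f = signComp X₁ X₂ f := by
      intro f hf
      by_cases h : Y₂ f = 0
      · exact Or.inl h
      · rw [comp_symm hf]
        exact Or.inr ((h₂.trans (conf_comp X₂ X₁)) f h)
    by_cases hY₁e : Y₁ e = 0
    · exact ⟨Y₁, hY₁, hY₁e, hσ₁, c1⟩
    by_cases hY₂e : Y₂ e = 0
    · refine ⟨Y₂, hY₂, hY₂e, hσ₂.resolve_right ?_, c2⟩
      rintro ⟨rfl, -⟩
      exact (sep_symm he).1 hY₂e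
    have hsep : e ∈ signSep Y₁ Y₂ := ⟨hY₁e, by rw [h₁ e hY₁e, h₂ e hY₂e]; exact he.2⟩
    obtain ⟨Z, hZ, hZe, hZ'⟩ := O.elim Y₁ hY₁ Y₂ hY₂ e hsep
    refine ⟨Z, hZ, hZe, lexSign_elim I Y₁ Y₂ Z s hs hσ₁ ?_ hZ', fun f hf => ?_⟩
    · rcases hσ₂ with h | ⟨rfl, h⟩
      · exact Or.inr h
      · exact Or.inl h
    · have hf' : f ∉ signSep Y₁ Y₂ := fun h => hf
        ⟨h₁ f h.1 ▸ h.1, by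
          rw [← h₁ f h.1, ← h₂ f (sep_symm h).1]
          exact h.2⟩
      rw [hZ' f hf']
      by_cases h : Y₁ f = 0
      · simpa [signComp, h] using c2 f hf
      · have := c1 f hf
        rw [show signComp Y₁ Y₂ f = Y₁ f by simp [signComp, h]]
        exact this
  obtain ⟨Z, hZ, hZe, hσ, hZ'⟩ := main
  obtain ⟨X, hX, hXe, hX'⟩ := O.elim X₁ hX₁ X₂ hX₂ e he
  have hZX := O.comp_mem Z hZ X hX
  refine ⟨signComp Z X, hZX, by simp [signComp, hZe, hXe], fun f hf => ?_, ?_⟩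
  · by_cases h : Z f = 0
    · simpa [signComp, h] using hX' f hf
    · rw [← (hZ' f hf).resolve_left h]
      simp [signComp, h]
  · rw [← hσ]
    exact LexCov.of_conf hZX hZ (conf_comp Z X) (hσ ▸ hs)

theorem lex_elim_p {α : Type*} {O : OrientedMatroid α} {I : List α} : ∀ (n : ℕ)
    (X₁ X₂ : α → SignType), (signSep X₁ X₂).ncard = n → O.LexCov I X₁ 1 → O.LexCov I X₂ (-1) →
    ∃ Z, O.LexCov I Z 0 ∧ ∀ f, f ∉ signSep X₁ X₂ → Z f = signComp X₁ X₂ f := by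
  intro n
  induction n using Nat.strong_induction_on with
  | _ n ih =>
    intro X₁ X₂ hn h₁ h₂
    have hfin : (signSep X₁ X₂).Finite := O.finite.subset fun a ha => by
      by_contra h
      exact ha.1 (O.eq_zero_of_notMem X₁ h₁.1 a h)
    rcases (signSep X₁ X₂).eq_empty_or_nonempty with hemp | ⟨e, he⟩
    · obtain ⟨Y₁, hY₁, hc₁, hσ₁⟩ := h₁.witness (by decide)
      obtain ⟨Y₂, hY₂, hc₂, hσ₂⟩ := h₂.witness (by decide)
      refine ⟨signComp X₁ X₂, ?_, fun _ _ => rfl⟩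
      have hc : Conf X₂ (signComp X₁ X₂) := fun f hf => by
        rw [comp_symm (by rw [hemp]; exact Set.notMem_empty f)]
        exact conf_comp X₂ X₁ f hf
      exact LexCov.of_conf_conf (O.comp_mem _ h₁.1 _ h₂.1) hY₁ (hc₁.trans (conf_comp _ _))
        (by rw [hσ₁]; decide) hY₂ (hc₂.trans hc) (by rw [hσ₁, hσ₂]) 0
    · obtain ⟨X, hX, hXe, hX'⟩ := O.elim X₁ h₁.1 X₂ h₂.1 e he
      have point : ∀ f, f ∉ signSep X₁ X₂ →
          (f ∉ signSep X X₂ ∧ signComp X X₂ f = signComp X₁ X₂ f) ∧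
          (f ∉ signSep X₁ X ∧ signComp X₁ X f = signComp X₁ X₂ f) := by
        intro f hf
        have := hX' f hf
        simp only [signSep, signComp, Set.mem_ofPred_eq] at hf this ⊢
        rw [this]
        revert hf
        generalize X₁ f = x
        generalize X₂ f = y
        revert x y
        decide
      rcases SignType.trichotomy (lexSign I X) with h | h | h
      · have hlt : (signSep X₁ X).ncard < n := by
          rw [← hn]
          refine Set.ncard_lt_ncard ⟨fun f hf => ?_, fun h => ?_⟩ hfin
          · by_contra h'
            exact (point f h').2.1 hf
          · exact (sep_symm (h he)).1 hXe
        obtain ⟨Z, hZ, hZ'⟩ := ih _ hlt X₁ X rfl h₁ ⟨hX, Or.inl h.symm⟩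
        exact ⟨Z, hZ, fun f hf => (hZ' f (point f hf).2.1).trans (point f hf).2.2⟩
      · exact ⟨X, ⟨hX, Or.inl h.symm⟩, hX'⟩
      · have hlt : (signSep X X₂).ncard < n := by
          rw [← hn]
          refine Set.ncard_lt_ncard ⟨fun f hf => ?_, fun h => ?_⟩ hfin
          · by_contra h'
            exact (point f h').1.1 hf
          · exact (h he).1 hXe
        obtain ⟨Z, hZ, hZ'⟩ := ih _ hlt X X₂ rfl ⟨hX, Or.inl h.symm⟩ h₂
        exact ⟨Z, hZ, fun f hf => (hZ' f (point f hf).1.1).trans (point f hf).1.2⟩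

theorem lex_elim_sign {α : Type*} {O : OrientedMatroid α} {I : List α} {X₁ X₂ : α → SignType}
    {e : α} {s s₁ s₂ : SignType} (he : e ∈ signSep X₁ X₂) (h₁ : O.LexCov I X₁ s₁)
    (h₂ : O.LexCov I X₂ s₂) (hs : s ≠ 0) (hs₁ : s₁ = 0 ∨ s₁ = s) (hs₂ : s₂ = 0 ∨ s₂ = s)
    (hne : ¬ (lexSign I X₁ = 0 ∧ lexSign I X₂ = 0)) :
    ∃ Z, Z e = 0 ∧ (∀ f, f ∉ signSep X₁ X₂ → Z f = signComp X₁ X₂ f) ∧ O.LexCov I Z s := by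
  have wit : ∀ (X : α → SignType) (t : SignType), O.LexCov I X t → t = 0 ∨ t = s →
      lexSign I X = 0 ∨ ∃ Y ∈ O.covectors, Conf Y X ∧ lexSign I Y = s := by
    rintro X t h (rfl | rfl)
    · exact h.witness_zero s hs
    · exact Or.inr (h.witness hs)
  have r : ∀ X : α → SignType, Conf X X := fun _ _ _ => rfl
  rcases wit X₁ s₁ h₁ hs₁ with z₁ | ⟨Y₁, hY₁, c₁, σ₁⟩
  · rcases wit X₂ s₂ h₂ hs₂ with z₂ | ⟨Y₂, hY₂, c₂, σ₂⟩
    · exact absurd ⟨z₁, z₂⟩ hne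
    · obtain ⟨Z, -, hZe, hZ', hZ⟩ := lex_elim_aux hs (sep_symm he) h₂.1 h₁.1 hY₂ h₁.1 c₂ (r _)
        σ₂ (Or.inr ⟨rfl, z₁⟩)
      exact ⟨Z, hZe, fun f hf => (hZ' f fun h => hf (sep_symm h)).trans (comp_symm hf).symm, hZ⟩
  · rcases wit X₂ s₂ h₂ hs₂ with z₂ | ⟨Y₂, hY₂, c₂, σ₂⟩
    · obtain ⟨Z, -, hZe, hZ', hZ⟩ := lex_elim_aux hs he h₁.1 h₂.1 hY₁ h₂.1 c₁ (r _)
        σ₁ (Or.inr ⟨rfl, z₂⟩)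
      exact ⟨Z, hZe, hZ', hZ⟩
    · obtain ⟨Z, -, hZe, hZ', hZ⟩ := lex_elim_aux hs he h₁.1 h₂.1 hY₁ hY₂ c₁ c₂ σ₁ (Or.inl σ₂)
      exact ⟨Z, hZe, hZ', hZ⟩

theorem lex_elim {α : Type*} {O : OrientedMatroid α} {I : List α} {X₁ X₂ : α → SignType}
    {e : α} {s₁ s₂ : SignType} (he : e ∈ signSep X₁ X₂) (h₁ : O.LexCov I X₁ s₁)
    (h₂ : O.LexCov I X₂ s₂) :
    ∃ Z t, O.LexCov I Z t ∧ Z e = 0 ∧ (∀ f, f ∉ signSep X₁ X₂ → Z f = signComp X₁ X₂ f) ∧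
      (¬ (s₁ ≠ 0 ∧ s₁ = -s₂) → t = if s₁ = 0 then s₂ else s₁) := by
  obtain ⟨X, hX, hXe, hX'⟩ := O.elim X₁ h₁.1 X₂ h₂.1 e he
  by_cases hsep : s₁ ≠ 0 ∧ s₁ = -s₂
  · exact ⟨X, lexSign I X, ⟨hX, Or.inl rfl⟩, hXe, hX', fun h => absurd hsep h⟩
  by_cases hz : lexSign I X₁ = 0 ∧ lexSign I X₂ = 0
  · have zz : ∀ (Y : α → SignType) (t : SignType), O.LexCov I Y t → lexSign I Y = 0 → t = 0 := by
      rintro Y t ⟨-, rfl | ⟨Z, -, -, h0, h1⟩⟩ hY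
      · exact hY
      · rw [h1, hY] at h0
        exact absurd neg_zero h0
    have t₁ := zz _ _ h₁ hz.1
    have t₂ := zz _ _ h₂ hz.2
    refine ⟨X, 0, ⟨hX, Or.inl ?_⟩, hXe, hX', fun _ => by simp [t₁, t₂]⟩
    symm
    rw [lexSign_eq_zero_iff]
    intro a ha
    have a₁ := (lexSign_eq_zero_iff _ _).1 hz.1 a ha
    have a₂ := (lexSign_eq_zero_iff _ _).1 hz.2 a ha
    rw [hX' a fun h => h.1 a₁]
    simp [signComp, a₁, a₂]
  by_cases hs : (if s₁ = 0 then s₂ else s₁) = 0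
  · obtain ⟨rfl, rfl⟩ : s₁ = 0 ∧ s₂ = 0 := by
      revert hs
      clear * -
      revert s₁ s₂
      decide
    obtain ⟨A, hAe, hA', hA⟩ := lex_elim_sign (s := 1) he h₁ h₂ (by decide) (Or.inl rfl)
      (Or.inl rfl) hz
    obtain ⟨B, hBe, hB', hB⟩ := lex_elim_sign (s := -1) he h₁ h₂ (by decide) (Or.inl rfl)
      (Or.inl rfl) hz
    obtain ⟨Z, hZ, hZ'⟩ := lex_elim_p _ A B rfl hA hB
    refine ⟨Z, 0, hZ, ?_, fun f hf => ?_, fun _ => by simp⟩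
    · rw [hZ' e fun h => h.1 hAe]
      simp [signComp, hAe, hBe]
    · have hAf := hA' f hf
      have hBf := hB' f hf
      have hAB : f ∉ signSep A B := by
        rintro ⟨h, h'⟩
        rw [hBf, ← hAf] at h'
        revert h h'
        generalize A f = x
        revert x
        decide
      rw [hZ' f hAB, ← hAf]
      simp only [signComp] at hAf hBf ⊢
      rw [hBf, ← hAf]
      simp
  · obtain ⟨Z, hZe, hZ', hZ⟩ := lex_elim_sign (s := if s₁ = 0 then s₂ else s₁) he h₁ h₂ hs
      (by revert hsep; clear * -; revert s₁ s₂; decide)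
      (by revert hsep; clear * -; revert s₁ s₂; decide) hz
    exact ⟨Z, _, hZ, hZe, hZ', fun _ => rfl⟩

open Classical in
theorem LexCov.congr {α : Type*} {O : OrientedMatroid α} {I : List α} {p : α}
    {X W : α → SignType} {s t : SignType} (h : O.LexCov I X s) (hX : Function.update W p 0 = X)
    (ht : t = s) : O.LexCov I (Function.update W p 0) t := by
  rw [hX, ht]
  exact h

open Classical in
/-- The positive lexicographic extension, constructed through its covectors. -/
noncomputable def positiveLexExtension {α : Type*} (O : OrientedMatroid α) (I : List α) (p : α)
    (hp : p ∉ O.E) : OrientedMatroid α where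
  E := insert p O.E
  finite := O.finite.insert p
  covectors := {W | O.LexCov I (Function.update W p 0) (W p)}
  eq_zero_of_notMem W hW e he := by
    have hep : e ≠ p := fun h => he (h ▸ Set.mem_insert _ _)
    have := O.eq_zero_of_notMem _ hW.1 e fun h => he (Set.mem_insert_of_mem _ h)
    simpa [Function.update_of_ne hep] using this
  zero_mem := by
    have h0 : lexSign I (0 : α → SignType) = 0 := (lexSign_eq_zero_iff _ _).2 fun _ _ => rfl
    refine LexCov.congr (X := 0) (s := 0) ⟨O.zero_mem, Or.inl h0.symm⟩ ?_ rfl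
    ext1 e
    by_cases h : e = p <;> simp [h]
  neg_mem W hW := by
    refine LexCov.congr (LexCov.neg hW) ?_ rfl
    ext1 e
    by_cases h : e = p <;> simp [h]
  comp_mem W hW V hV := by
    refine LexCov.congr (LexCov.comp hW hV) ?_ rfl
    ext1 e
    by_cases h : e = p <;> simp [h, signComp]
  elim W hW V hV e he := by
    have sep_iff : ∀ f, f ≠ p → (f ∈ signSep (Function.update W p 0) (Function.update V p 0) ↔
        f ∈ signSep W V) := by
      intro f hf
      simp [signSep, Function.update_of_ne hf]
    have pz : ∀ Z ∈ O.covectors, Z p = 0 := fun Z hZ => O.eq_zero_of_notMem Z hZ p hp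
    have fin : ∀ (Z : α → SignType) (t : SignType), O.LexCov I Z t →
        O.LexCov I (Function.update (Function.update Z p t) p 0) (Function.update Z p t p) := by
      intro Z t h
      refine h.congr ?_ (by simp)
      rw [Function.update_idem]
      nth_rewrite 1 [← pz Z h.1]
      exact Function.update_eq_self p Z
    by_cases hep : e = p
    · subst hep
      have key : ∃ Z, O.LexCov I Z 0 ∧ ∀ f,
          f ∉ signSep (Function.update W e 0) (Function.update V e 0) →
            Z f = signComp (Function.update W e 0) (Function.update V e 0) f := by
        obtain ⟨h1, h2⟩ := he
        have of_eq : ∀ (U : α → SignType) (t : SignType),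
            O.LexCov I (Function.update U e 0) (U e) → U e = t →
            O.LexCov I (Function.update U e 0) t := fun U t h h' => h' ▸ h
        rcases SignType.trichotomy (W e) with h | h | h
        · have hV1 : V e = 1 := by
            rw [h] at h2
            revert h2
            generalize V e = v
            revert v
            decide
          obtain ⟨Z, hZ, hZ'⟩ := lex_elim_p _ _ _ rfl (of_eq V 1 hV hV1) (of_eq W (-1) hW h)
          exact ⟨Z, hZ, fun f hf =>
            (hZ' f fun h => hf (sep_symm h)).trans (comp_symm hf).symm⟩
        · exact absurd h h1
        · have hV1 : V e = -1 := by
            rw [h] at h2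
            revert h2
            generalize V e = v
            revert v
            decide
          exact lex_elim_p _ _ _ rfl (of_eq W 1 hW h) (of_eq V (-1) hV hV1)
      obtain ⟨Z, hZ, hZ'⟩ := key
      refine ⟨Function.update Z e 0, fin Z 0 hZ, by simp, fun f hf => ?_⟩
      have hfe : f ≠ e := fun h => hf (h ▸ he)
      rw [Function.update_of_ne hfe, hZ' f (fun h => hf ((sep_iff f hfe).1 h))]
      simp [signComp, Function.update_of_ne hfe]
    · obtain ⟨Z, t, hZ, hZe, hZ', ht⟩ := lex_elim ((sep_iff e hep).2 he) hW hV
      refine ⟨Function.update Z p t, fin Z t hZ, by rw [Function.update_of_ne hep, hZe],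
        fun f hf => ?_⟩
      by_cases hfp : f = p
      · subst hfp
        simpa [signComp] using ht hf
      · rw [Function.update_of_ne hfp, hZ' f (fun h => hf ((sep_iff f hfp).1 h))]
        simp [signComp, Function.update_of_ne hfp]

/-- The positive lexicographic extension exists. -/
theorem isPositiveLexExtension_positiveLexExtension {α : Type*} (O : OrientedMatroid α)
    (I : List α) (p : α) (hp : p ∉ O.E) :
    O.IsPositiveLexExtension I p (O.positiveLexExtension I p hp) := by
  classical
  have pz : ∀ Z ∈ O.covectors, Z p = 0 := fun Z hZ => O.eq_zero_of_notMem Z hZ p hp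
  have upd : ∀ Z ∈ O.covectors, Function.update Z p 0 = Z := by
    intro Z hZ
    nth_rewrite 1 [← pz Z hZ]
    exact Function.update_eq_self p Z
  have lift : ∀ Z ∈ O.covectors,
      Function.update Z p (lexSign I Z) ∈ (O.positiveLexExtension I p hp).covectors := by
    intro Z hZ
    refine LexCov.congr (X := Z) (s := lexSign I Z) ⟨hZ, Or.inl rfl⟩ ?_ (by simp)
    rw [Function.update_idem, upd Z hZ]
  have zero_of : ∀ W ∈ (O.positiveLexExtension I p hp).covectors,
      Function.update W p 0 = 0 → W p = 0 := by
    rintro W ⟨-, h | ⟨Y, -, -, h0, h1⟩⟩ hW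
    · rw [h, hW]
      exact (lexSign_eq_zero_iff _ _).2 fun _ _ => rfl
    · rw [h1, hW, (lexSign_eq_zero_iff I 0).2 fun _ _ => rfl] at h0
      exact absurd neg_zero h0
  refine ⟨hp, rfl, ?_, ?_, ?_⟩
  · ext Z
    constructor
    · rintro ⟨W, hW, rfl⟩
      exact hW.1
    · intro hZ
      refine ⟨_, lift Z hZ, ?_⟩
      simp only [Function.update_idem]
      convert upd Z hZ
  · have hpE : p ∈ (O.positiveLexExtension I p hp).toMatroid.E := Set.mem_insert _ _
    rw [Matroid.isColoop_iff_notMem_closure_compl hpE, not_not, toMatroid_E,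
      mem_closure_iff _ Set.sdiff_subset hpE]
    intro W hW hW0
    refine zero_of W hW ?_
    ext1 e
    by_cases hep : e = p
    · simp [hep]
    · rw [Function.update_of_ne hep]
      by_cases he : e ∈ (O.positiveLexExtension I p hp).E
      · exact hW0 e ⟨he, hep⟩
      · exact OrientedMatroid.eq_zero_of_notMem _ W hW e he
  · rintro Y ⟨hY, hY0, hmin⟩
    have hsub : ∀ W ∈ (O.positiveLexExtension I p hp).covectors, W ≠ 0 →
        Function.support W ⊆ Function.support (Function.update Y p (lexSign I Y)) →
        Function.support (Function.update Y p (lexSign I Y)) ⊆ Function.support W := by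
      intro W hW hWn hs
      have hX : Function.update W p 0 ∈ O.covectors := hW.1
      have hXn : Function.update W p 0 ≠ 0 := fun h => hWn (by
        ext1 e
        by_cases hep : e = p
        · rw [hep]
          exact zero_of W hW h
        · simpa [Function.update_of_ne hep] using congrFun h e)
      have hXs : Function.support (Function.update W p 0) ⊆ Function.support Y := by
        intro e he
        have hep : e ≠ p := by
          rintro rfl
          simp at he
        have := hs (show e ∈ Function.support W by
          simpa [Function.update_of_ne hep] using he)
        simpa [Function.update_of_ne hep] using this
      have hYX := hmin _ hX hXn hXs
      intro e he
      by_cases hep : e = p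
      · subst hep
        have hσY : lexSign I Y ≠ 0 := by simpa using he
        have hσX : lexSign I (Function.update W e 0) ≠ 0 := by
          intro h
          refine hσY ((lexSign_eq_zero_iff _ _).2 fun a ha => ?_)
          by_contra hYa
          exact hYX hYa ((lexSign_eq_zero_iff _ _).1 h a ha)
        obtain ⟨-, h | ⟨Z, hZ, hZX, h0, h1⟩⟩ := hW
        · rw [Function.mem_support, h]
          exact hσX
        · exfalso
          have hZn : Z ≠ 0 := by
            rintro rfl
            exact h0 ((lexSign_eq_zero_iff _ _).2 fun _ _ => rfl)
          have hZs : Function.support Z ⊆ Function.support (Function.update W e 0) := by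
            intro a ha
            rw [Function.mem_support, ← hZX a ha]
            exact ha
          have hYZ := hmin Z hZ hZn (hZs.trans hXs)
          have hZeq : Z = Function.update W e 0 := by
            ext1 a
            by_cases ha : Z a = 0
            · rw [ha]
              by_contra hne
              exact hYZ (hXs (show a ∈ Function.support (Function.update W e 0) from
                fun h => hne h.symm)) ha
            · exact hZX a ha
          rw [hZeq] at h1
          revert hσX h1
          generalize lexSign I (Function.update W e 0) = x
          revert x
          decide
      · have := hYX (show e ∈ Function.support Y by
          simpa [Function.update_of_ne hep] using he)
        simpa [Function.update_of_ne hep] using this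
    refine ⟨lift Y hY, fun h => hY0 ?_, hsub⟩
    have := congrArg (fun W => Function.update W p 0) h
    simp only [Function.update_idem] at this
    rw [upd Y hY] at this
    rw [this]
    ext1 e
    by_cases hep : e = p <;> simp [hep]

end OrientedMatroid

/-! ### Cocircuits, colines of comodular pairs, elimination along edges -/

namespace OrientedMatroid

/-! A directed cycle for `(O', p, f)` is transported to a directed cycle of one of the given
contractions. Along an edge that is not directed backwards the sign at `f` cannot decrease, so on a
directed cycle it is a constant `c`; if `c` were `0`, every edge would be undirected. Let `I[i]` be
the first element of the list at which some vertex of the cycle is nonzero. All vertices vanish on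
the earlier elements, and the lexicographic rule together with the sign `+` at `p` leaves only `0`
and `+` at `I[i]`.

An edge from `0` to `+` at `I[i]` has an eliminating cocircuit with sign `-c` at `f`
(`elimination_apply_of_leaving`). Hence the sign at `I[i]` is monotone along the cycle, so constant,
so `+` everywhere. Erasing `p` now gives a closed path in the cocircuit graph of the contraction by
the earlier elements, with `I[i]` in the role of `p`. By `elimination_apply_eq` eliminating `p`
upstairs and `I[i]` downstairs produce the same sign at `f`, so the image is again a directed cycle,
against the hypothesis. General position serves only for this comparison.

Both comparisons take place in the coline of an edge, the intersection of the two zero sets. This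
flat has corank at most two, so covectors vanishing on it and on one more element have a determined
zero set (`Comodular.eq_zero`). With a further zero at an old element, such a covector has the
lexicographic sign at `p` (`apply_eq_lexSign`). Each comparison assumes a wrong sign and eliminates
to a covector that breaks this rule. -/

theorem mem_ground_of_ne_zero {α : Type*} {O : OrientedMatroid α} {X : α → SignType} {e : α}
    (hX : X ∈ O.covectors) (h : X e ≠ 0) : e ∈ O.E := by
  by_contra h'
  exact h (O.eq_zero_of_notMem X hX e h')

theorem notMem_closure_of_ne_zero {α : Type*} {O : OrientedMatroid α} {A : Set α}
    {X : α → SignType} {e : α} (hA : A ⊆ O.E) (hX : X ∈ O.covectors) (hXA : ∀ a ∈ A, X a = 0)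
    (h : X e ≠ 0) : e ∉ O.toMatroid.closure A := fun he =>
  h ((O.mem_closure_iff hA (mem_ground_of_ne_zero hX h)).1 he X hX hXA)

theorem eRk_insert_of_ne_zero {α : Type*} {O : OrientedMatroid α} {A : Set α}
    {X : α → SignType} {e : α} (hA : A ⊆ O.E) (hX : X ∈ O.covectors) (hXA : ∀ a ∈ A, X a = 0)
    (h : X e ≠ 0) : O.toMatroid.eRk (insert e A) = O.toMatroid.eRk A + 1 :=
  Matroid.eRk_insert_eq_add_one
    ⟨mem_ground_of_ne_zero hX h, notMem_closure_of_ne_zero hA hX hXA h⟩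

theorem zeroSet_subset {α : Type*} {O : OrientedMatroid α} {X : α → SignType} :
    O.zeroSet X ⊆ O.E := fun _ h => h.1

theorem eRk_ne_top {α : Type*} (O : OrientedMatroid α) (A : Set α) :
    O.toMatroid.eRk A ≠ ⊤ := by
  rw [← O.toMatroid.eRk_inter_ground]
  have hfin : (A ∩ O.toMatroid.E).Finite := O.finite.subset Set.inter_subset_right
  exact ne_top_of_le_ne_top hfin.encard_lt_top.ne (O.toMatroid.eRk_le_encard _)

/-- The zero set of a cocircuit is a hyperplane. -/
theorem eRank_le_of_mem_cocircuits {α : Type*} {O : OrientedMatroid α} {X : α → SignType}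
    (hX : X ∈ O.cocircuits) : O.toMatroid.eRank ≤ O.toMatroid.eRk (O.zeroSet X) + 1 := by
  obtain ⟨hXO, hX0, hmin⟩ := hX
  obtain ⟨e, he⟩ := Function.ne_iff.1 hX0
  have heE : e ∈ O.E := mem_ground_of_ne_zero hXO he
  have hsub : insert e (O.zeroSet X) ⊆ O.E := Set.insert_subset heE zeroSet_subset
  refine le_trans ?_ (O.toMatroid.eRk_insert_le_add_one e _)
  rw [← O.toMatroid.eRk_closure_eq, O.toMatroid.eRank_def]
  -- One element `e` of the support already completes the zero set to a spanning set: a nonzero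
  -- covector vanishing on both would have support strictly inside that of `X`.
  refine O.toMatroid.eRk_mono fun c hc => (O.mem_closure_iff hsub hc).2 fun V hV hV0 => ?_
  by_contra hVc
  refine hmin V hV (fun h => hVc (congrFun h c)) (fun a ha => ?_) he (hV0 e (Set.mem_insert _ _))
  intro hXa
  exact ha (hV0 a (Set.mem_insert_of_mem _ ⟨mem_ground_of_ne_zero hV ha, hXa⟩))

/-- In the coline of a comodular pair, a further vanishing element determines the zero set. -/
theorem Comodular.eq_zero {α : Type*} {O : OrientedMatroid α} {X Y Z₁ Z₂ : α → SignType} {e c : α}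
    (h : O.Comodular X Y) (hX : X ∈ O.cocircuits) (hY : Y ∈ O.cocircuits)
    (h₁ : Z₁ ∈ O.covectors) (h₂ : Z₂ ∈ O.covectors) (hne : Z₁ ≠ 0)
    (hF₁ : ∀ a, X a = 0 → Y a = 0 → Z₁ a = 0) (hF₂ : ∀ a, X a = 0 → Y a = 0 → Z₂ a = 0)
    (he : X e ≠ 0 ∨ Y e ≠ 0) (he₁ : Z₁ e = 0) (he₂ : Z₂ e = 0) (hc : Z₁ c = 0) : Z₂ c = 0 := by
  by_contra hc₂
  obtain ⟨d, hd⟩ := Function.ne_iff.1 hne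
  set F := O.zeroSet X ∩ O.zeroSet Y with hF
  have hFE : F ⊆ O.E := Set.inter_subset_left.trans zeroSet_subset
  have heE : e ∈ O.E := he.elim (mem_ground_of_ne_zero hX.1) (mem_ground_of_ne_zero hY.1)
  have hcE : c ∈ O.E := mem_ground_of_ne_zero h₂ hc₂
  -- If `Z₂ c ≠ 0`, adjoining `e`, `c`, `d` to `F` raises the rank three times. But `F` has rank at
  -- least `r - 2`, since the two zero sets have rank at least `r - 1` and their union at most `r`.
  have r1 : O.toMatroid.eRk (insert e F) = O.toMatroid.eRk F + 1 := he.elim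
    (fun he => eRk_insert_of_ne_zero hFE hX.1 (fun a ha => ha.1.2) he)
    (fun he => eRk_insert_of_ne_zero hFE hY.1 (fun a ha => ha.2.2) he)
  have hF1 : insert e F ⊆ O.E := Set.insert_subset heE hFE
  have r2 : O.toMatroid.eRk (insert c (insert e F)) = O.toMatroid.eRk (insert e F) + 1 := by
    refine eRk_insert_of_ne_zero hF1 h₂ ?_ hc₂
    rintro a (rfl | ha)
    · exact he₂
    · exact hF₂ a ha.1.2 ha.2.2
  have r3 : O.toMatroid.eRk (insert d (insert c (insert e F))) =
      O.toMatroid.eRk (insert c (insert e F)) + 1 := by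
    refine eRk_insert_of_ne_zero (Set.insert_subset hcE hF1) h₁ ?_ hd
    rintro a (rfl | rfl | ha)
    · exact hc
    · exact he₁
    · exact hF₁ a ha.1.2 ha.2.2
  have r4 := O.toMatroid.eRk_le_eRank (insert d (insert c (insert e F)))
  have r5 := O.toMatroid.eRk_le_eRank (O.zeroSet X ∪ O.zeroSet Y)
  have r6 := eRank_le_of_mem_cocircuits hX
  have r7 := eRank_le_of_mem_cocircuits hY
  have h' : O.toMatroid.eRk (O.zeroSet X) + O.toMatroid.eRk (O.zeroSet Y) =
    O.toMatroid.eRk (O.zeroSet X ∪ O.zeroSet Y) + O.toMatroid.eRk F := h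
  rw [r3, r2, r1] at r4
  have t := O.eRk_ne_top O.toMatroid.E
  rw [O.toMatroid.eRk_ground] at t
  have t1 := O.eRk_ne_top (O.zeroSet X)
  have t2 := O.eRk_ne_top (O.zeroSet Y)
  have t3 := O.eRk_ne_top (O.zeroSet X ∪ O.zeroSet Y)
  have t4 := O.eRk_ne_top F
  generalize O.toMatroid.eRank = r at *
  generalize O.toMatroid.eRk (O.zeroSet X) = x at *
  generalize O.toMatroid.eRk (O.zeroSet Y) = y at *
  generalize O.toMatroid.eRk (O.zeroSet X ∪ O.zeroSet Y) = u at *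
  generalize O.toMatroid.eRk F = v at *
  lift r to ℕ using t
  lift x to ℕ using t1
  lift y to ℕ using t2
  lift u to ℕ using t3
  lift v to ℕ using t4
  norm_cast at *
  omega

/-- In the coline of a comodular pair, a nonzero covector with a further zero is a cocircuit. -/
theorem Comodular.mem_cocircuits {α : Type*} {O : OrientedMatroid α} {X Y Z : α → SignType} {e : α}
    (h : O.Comodular X Y) (hX : X ∈ O.cocircuits) (hY : Y ∈ O.cocircuits)
    (hZ : Z ∈ O.covectors) (hne : Z ≠ 0) (hF : ∀ a, X a = 0 → Y a = 0 → Z a = 0)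
    (he : X e ≠ 0 ∨ Y e ≠ 0) (heZ : Z e = 0) : Z ∈ O.cocircuits := by
  refine ⟨hZ, hne, fun V hV hV0 hs c hc hVc => hc ?_⟩
  have hz : ∀ a, Z a = 0 → V a = 0 := fun a ha => by
    by_contra hVa
    exact hs hVa ha
  exact h.eq_zero hX hY hV hZ hV0 (fun a h1 h2 => hz a (hF a h1 h2)) hF he (hz e heZ) heZ hVc

theorem neg_mem_cocircuits {α : Type*} {O : OrientedMatroid α} {X : α → SignType}
    (hX : X ∈ O.cocircuits) : -X ∈ O.cocircuits := by
  refine ⟨O.neg_mem X hX.1, fun h => hX.2.1 (funext fun a => by simpa using congrFun h a),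
    fun V hV hV0 hs => ?_⟩
  have hsupp : Function.support (-X) = Function.support X := by
    ext
    simp
  rw [hsupp] at hs ⊢
  exact hX.2.2 V hV hV0 hs

theorem sign_sep {s t : SignType} (hs : s ≠ 0) (ht : t ≠ 0) (h : s ≠ t) : s = -t := by
  revert s t
  decide

/-- A covector supported within a cocircuit and agreeing with it somewhere equals it. -/
theorem eq_of_mem_cocircuits {α : Type*} {O : OrientedMatroid α} {X V : α → SignType} {d : α}
    (hX : X ∈ O.cocircuits) (hV : V ∈ O.covectors) (hs : ∀ a, X a = 0 → V a = 0)
    (hd : X d ≠ 0) (hVd : V d = X d) : V = X := by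
  have hV0 : V ≠ 0 := fun h => hd (by rw [← hVd, h]; rfl)
  have hsup := hX.2.2 V hV hV0 fun a ha h => ha (hs a h)
  by_contra hne
  obtain ⟨e, he⟩ := Function.ne_iff.1 hne
  have hXe : X e ≠ 0 := fun h => he (by rw [h, hs e h])
  have hVe : V e ≠ 0 := hsup hXe
  -- The supports agree, so a disagreement at `e` is an opposition of signs. Eliminating `e` leaves
  -- the value at `d` intact and shrinks the support of the cocircuit `X`.
  obtain ⟨Z, hZ, hZe, hZ'⟩ := O.elim V hV X hX.1 e ⟨hVe, sign_sep hVe hXe he⟩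
  have hZd : Z d = X d := by
    rw [hZ' d]
    · simp [signComp, hVd]
    · rintro ⟨h1, h2⟩
      rw [hVd] at h1 h2
      revert h1 h2
      generalize X d = x
      revert x
      decide
  refine hX.2.2 Z hZ (fun h => hd (by rw [← hZd, h]; rfl)) (fun a ha hXa => ha ?_) hXe hZe
  have hVa := hs a hXa
  rw [hZ' a fun h => h.1 hVa]
  simp [signComp, hVa, hXa]

theorem exists_cocircuit_of_ne_zero {α : Type*} {O : OrientedMatroid α} {X : α → SignType}
    (hX : X ∈ O.covectors) (h0 : X ≠ 0) :
    ∃ V ∈ O.cocircuits, Function.support V ⊆ Function.support X := by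
  have hfin : {S : Set α | ∃ V ∈ O.covectors, V ≠ 0 ∧ Function.support V = S}.Finite :=
    O.finite.finite_subsets.subset (by
      rintro _ ⟨V, hV, -, rfl⟩ a ha
      exact mem_ground_of_ne_zero hV ha)
  obtain ⟨S, hle, hS⟩ := hfin.exists_le_minimal ⟨X, hX, h0, rfl⟩
  obtain ⟨⟨V, hV, hV0, rfl⟩, hmin⟩ := hS
  exact ⟨V, ⟨hV, hV0, fun W hW hW0 hs => hmin ⟨W, hW, hW0, rfl⟩ hs⟩, hle⟩

theorem eq_of_mem_signSep_neg {α : Type*} {X Y : α → SignType} {a : α} (ha : a ∈ signSep (-X) Y) :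
    X a = Y a := by
  simpa using ha.2

/-- Where conformal vectors differ, one of them is zero. At such an element the sign of any
elimination is forced and nonzero, which is what makes eliminations exist as cocircuits, be unique
and be comparable. -/
theorem IsEdge.exists_ne {α : Type*} {O : OrientedMatroid α} {g : α}
    {X Y : α → SignType} (h : O.IsEdge g X Y) :
    ∃ d, d ∉ signSep (-X) Y ∧ signComp (-X) Y d ≠ 0 ∧ (X d = 0 ∨ Y d = 0) ∧
      (X d ≠ 0 ∨ Y d ≠ 0) ∧ X d ≠ Y d := by
  obtain ⟨d, hd⟩ := Function.ne_iff.1 h.2.2.1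
  have hsep : d ∉ signSep X Y := by rw [h.2.2.2.2]; exact Set.notMem_empty d
  refine ⟨d, ?_⟩
  simp only [signSep, signComp, Set.mem_ofPred_eq, Pi.neg_apply] at *
  revert hd hsep
  generalize X d = x
  generalize Y d = y
  revert x y
  decide

theorem IsElimination.eq_zero {α : Type*} {O : OrientedMatroid α} {g : α}
    {X Y Z : α → SignType} (h : O.IsElimination g (-X) Y Z) (a : α) (hX : X a = 0)
    (hY : Y a = 0) : Z a = 0 := by
  by_contra hZ
  rcases h.2.2 a hZ with h | h
  · exact hZ (by rw [h]; simp [hX])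
  · exact hZ (by rw [h, hY])

/-- Cocircuit elimination along an edge of the cocircuit graph exists. -/
theorem IsEdge.exists_isElimination {α : Type*} {O : OrientedMatroid α} {g : α}
    {X Y : α → SignType} (h : O.IsEdge g X Y) :
    ∃ Z, O.IsElimination g (-X) Y Z ∧ ∀ a, a ∉ signSep (-X) Y → Z a = signComp (-X) Y a := by
  obtain ⟨Z, hZ, hZg, hZ'⟩ := O.elim (-X) (O.neg_mem X h.1.1.1) Y h.2.1.1.1 g
    ⟨by simp [h.1.2], by simp [h.1.2, h.2.1.2]⟩
  obtain ⟨d, hd, hd', -⟩ := h.exists_ne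
  have hF : ∀ a, X a = 0 → Y a = 0 → Z a = 0 := fun a hX hY => by
    rw [hZ' a fun h => h.1 (by simp [hX])]
    simp [signComp, hX, hY]
  refine ⟨Z, ⟨h.2.2.2.1.mem_cocircuits h.1.1 h.2.1.1 hZ (fun h0 => hd' ?_) hF
    (e := g) (Or.inl (by simp [h.1.2])) hZg, hZg, fun a ha => ?_⟩, hZ'⟩
  · rw [← hZ' d hd, h0]
    rfl
  · by_cases hs : a ∈ signSep (-X) Y
    · obtain ⟨h1, h2⟩ := hs
      revert h1 h2 ha
      generalize (-X) a = x
      generalize Y a = y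
      generalize Z a = z
      revert x y z
      decide
    · rw [hZ' a hs]
      simp only [signComp]
      split_ifs <;> simp

/-- Cocircuit elimination along an edge of the cocircuit graph is unique. -/
theorem IsEdge.isElimination_unique {α : Type*} {O : OrientedMatroid α} {g : α}
    {X Y Z Z' : α → SignType} (h : O.IsEdge g X Y) (hZ : O.IsElimination g (-X) Y Z)
    (hZ' : O.IsElimination g (-X) Y Z') : Z' = Z := by
  obtain ⟨d, -, -, hd, hd', -⟩ := h.exists_ne
  have key : ∀ {Z Z' : α → SignType}, O.IsElimination g (-X) Y Z →
      O.IsElimination g (-X) Y Z' → ∀ a, Z a = 0 → Z' a = 0 := fun h1 h2 a ha =>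
    h.2.2.2.1.eq_zero h.1.1 h.2.1.1 h1.1.1 h2.1.1 h1.1.2.1 h1.eq_zero h2.eq_zero
      (e := g) (Or.inl (by simp [h.1.2])) h1.2.1 h2.2.1 ha
  -- `V` is the endpoint that vanishes at `d`. If `W` vanished there too, both would have the same
  -- zero set, although `V g = 1` and `W g = 0`.
  have hend : ∀ {V W : α → SignType}, O.IsVertex g V → (∀ a, X a = 0 → Y a = 0 → V a = 0) →
      V d = 0 → O.IsElimination g (-X) Y W → W d ≠ 0 := fun hV hVF hVd h1 h0 =>
    hV.1.2.2 _ h1.1.1 h1.1.2.1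
      (fun a ha hVa => ha (h.2.2.2.1.eq_zero h.1.1 h.2.1.1 hV.1.1 h1.1.1 hV.1.2.1 hVF h1.eq_zero
        hd' hVd h0 hVa)) (by simp [hV.2]) h1.2.1
  have hdZ : ∀ {W : α → SignType}, O.IsElimination g (-X) Y W → W d ≠ 0 := fun h1 =>
    hd.elim (fun hd => hend h.1 (fun _ h _ => h) hd h1)
      (fun hd => hend h.2.1 (fun _ _ h => h) hd h1)
  -- Both eliminations vanish at `g`, hence have equal zero sets, and their sign at `d` is the
  -- single nonzero one among `-X d` and `Y d`.
  refine eq_of_mem_cocircuits hZ.1 hZ'.1.1 (key hZ hZ') (hdZ hZ) ?_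
  have h1 := hZ.2.2 d (hdZ hZ)
  have h2 := hZ'.2.2 d (hdZ hZ')
  have h3 := hdZ hZ
  have h4 := hdZ hZ'
  revert hd h1 h2 h3 h4
  simp only [Pi.neg_apply]
  generalize X d = x
  generalize Y d = y
  generalize Z d = z
  generalize Z' d = z'
  revert x y z z'
  decide

theorem IsEdge.isElimination_apply {α : Type*} {O : OrientedMatroid α} {g a : α}
    {X Y Z : α → SignType} (h : O.IsEdge g X Y) (hZ : O.IsElimination g (-X) Y Z)
    (ha : a ∉ signSep (-X) Y) : Z a = signComp (-X) Y a := by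
  obtain ⟨W, hW, hW'⟩ := h.exists_isElimination
  rw [h.isElimination_unique hW hZ, hW' a ha]

/-- Traversing an edge backwards negates the eliminating cocircuit, so facts about one orientation
yield facts about the other. -/
theorem IsElimination.symm_neg {α : Type*} {O : OrientedMatroid α} {g : α}
    {X Y Z : α → SignType} (hZ : O.IsElimination g (-X) Y Z) :
    O.IsElimination g (-Y) X (-Z) := by
  refine ⟨neg_mem_cocircuits hZ.1, by simp [hZ.2.1], fun a ha => ?_⟩
  rcases hZ.2.2 a (by simpa using ha) with h | h
  · right
    simp [h]
  · left
    simp [h]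

theorem Comodular.symm {α : Type*} {O : OrientedMatroid α} {X Y : α → SignType}
    (h : O.Comodular X Y) : O.Comodular Y X := by
  unfold Comodular at *
  rw [add_comm, h, Set.union_comm, Set.inter_comm]

theorem IsEdge.symm {α : Type*} {O : OrientedMatroid α} {g : α} {X Y : α → SignType}
    (h : O.IsEdge g X Y) : O.IsEdge g Y X := by
  refine ⟨h.2.1, h.1, h.2.2.1.symm, h.2.2.2.1.symm, Set.eq_empty_of_forall_notMem fun a ha => ?_⟩
  have := sep_symm ha
  rw [h.2.2.2.2] at this
  exact this

/-- The sign at the objective does not decrease along an edge that is not directed backwards. -/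
theorem IsEdge.le_of_isElimination {α : Type*} {O : OrientedMatroid α} {g f : α}
    {X Y Z : α → SignType} (h : O.IsEdge g X Y) (hZ : O.IsElimination g (-X) Y Z)
    (hf : 0 ≤ Z f) : X f ≤ Y f := by
  by_cases ha : f ∈ signSep (-X) Y
  · exact (eq_of_mem_signSep_neg ha).le
  -- The sign is now `-X f` if that is nonzero, which forces `X f = -1`, and `Y f` otherwise.
  · rw [h.isElimination_apply hZ ha] at hf
    simp only [signSep, signComp, Set.mem_ofPred_eq, Pi.neg_apply] at *
    revert hf ha
    generalize X f = x
    generalize Y f = y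
    revert x y
    decide

/-! ### Contraction of an independent set -/

/-- The covector witnessing `a ∈ J` in the contraction vanishes on `A` and on the rest of `J`, so
the elements of `J` can be adjoined to `A` one at a time. -/
theorem contract_indep_iff {α : Type*} {O : OrientedMatroid α} {A : Set α} (hA : O.Indep A)
    {J : Set α} : (O.contract A).Indep J ↔ Disjoint J A ∧ O.Indep (J ∪ A) := by
  constructor
  · intro hJ
    have hJA : Disjoint J A := Set.disjoint_left.2 fun a h => (hJ.1 h).2
    refine ⟨hJA, ?_⟩
    have hJf : J.Finite := (O.contract A).finite.subset hJ.1
    refine hJf.induction_on_subset (motive := fun S _ => O.Indep (S ∪ A)) J (by simpa using hA) ?_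
    intro a S haJ hS haS ih
    obtain ⟨X, hX, hXa, hX'⟩ := hJ.2 a haJ
    rw [Set.insert_union]
    refine ih.insert_indep (hJ.1 haJ).1 hX.1 ?_ hXa
    rintro b (hb | hb)
    · exact hX' b (hS hb) (fun h => haS (h ▸ hb))
    · exact hX.2 b hb
  · rintro ⟨hd, hi⟩
    refine ⟨fun e he => ⟨hi.1 (Or.inl he), Set.disjoint_left.1 hd he⟩, fun e he => ?_⟩
    obtain ⟨X, hX, hXe, hX'⟩ := hi.2 e (Or.inl he)
    refine ⟨X, ⟨hX, fun a ha => hX' a (Or.inr ha) ?_⟩, hXe, fun b hb => hX' b (Or.inl hb)⟩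
    rintro rfl
    exact Set.disjoint_left.1 hd he ha

theorem toMatroid_contract {α : Type*} {O : OrientedMatroid α} {A : Set α} (hA : O.Indep A) :
    (O.contract A).toMatroid = O.toMatroid.contract A := by
  refine Matroid.ext_indep rfl fun J _ => ?_
  rw [Matroid.Indep.contract_indep_iff ((toMatroid_indep_iff O A).2 hA)]
  exact contract_indep_iff hA

theorem eRk_contract_add {α : Type*} {O : OrientedMatroid α} {A S : Set α} (hA : O.Indep A)
    (hAS : A ⊆ S) (hS : S ⊆ O.E) :
    (O.contract A).toMatroid.eRk (S \ A) + O.toMatroid.eRk A = O.toMatroid.eRk S := by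
  have hA' : O.toMatroid.Indep A := (toMatroid_indep_iff O A).2 hA
  rw [toMatroid_contract hA]
  obtain ⟨J, hJ⟩ := (O.toMatroid.contract A).exists_isBasis (S \ A)
    (fun a ha => ⟨hS ha.1, ha.2⟩)
  have hb := hA'.union_isBasis_union_of_contract_isBasis hJ
  rw [Set.sdiff_union_of_subset hAS] at hb
  rw [← hb.encard_eq_eRk, ← hJ.encard_eq_eRk, hA'.eRk_eq_encard, Set.encard_union_eq]
  exact Set.disjoint_left.2 fun a ha => (hJ.subset ha).2

/-- Contracting a common part of the two zero sets lowers all four ranks by the rank of `A`, which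
cancels in the modular equality. -/
theorem Comodular.contract {α : Type*} {O : OrientedMatroid α} {X Y : α → SignType}
    (h : O.Comodular X Y) {A : Set α} (hA : O.Indep A) (hX : ∀ a ∈ A, X a = 0)
    (hY : ∀ a ∈ A, Y a = 0) : (O.contract A).Comodular X Y := by
  have hz : ∀ X : α → SignType, (O.contract A).zeroSet X = O.zeroSet X \ A := by
    intro X
    ext a
    simp only [zeroSet, OrientedMatroid.contract, Set.mem_ofPred_eq, Set.mem_sdiff]
    tauto
  have hAX : A ⊆ O.zeroSet X := fun a ha => ⟨hA.1 ha, hX a ha⟩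
  have hAY : A ⊆ O.zeroSet Y := fun a ha => ⟨hA.1 ha, hY a ha⟩
  unfold Comodular at *
  rw [hz, hz, ← Set.union_sdiff_distrib, show O.zeroSet X \ A ∩ (O.zeroSet Y \ A) =
    (O.zeroSet X ∩ O.zeroSet Y) \ A by ext; simp only [Set.mem_inter_iff, Set.mem_sdiff]; tauto]
  have e1 := eRk_contract_add hA hAX zeroSet_subset
  have e2 := eRk_contract_add hA hAY zeroSet_subset
  have e3 := eRk_contract_add hA (S := O.zeroSet X ∪ O.zeroSet Y)
    (hAX.trans Set.subset_union_left) (Set.union_subset zeroSet_subset zeroSet_subset)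
  have e4 := eRk_contract_add hA (S := O.zeroSet X ∩ O.zeroSet Y)
    (Set.subset_inter hAX hAY) (Set.inter_subset_left.trans zeroSet_subset)
  rw [← e1, ← e2, ← e3, ← e4] at h
  have t0 := O.eRk_ne_top A
  have t1 := (O.contract A).eRk_ne_top (O.zeroSet X \ A)
  have t2 := (O.contract A).eRk_ne_top (O.zeroSet Y \ A)
  have t3 := (O.contract A).eRk_ne_top ((O.zeroSet X ∪ O.zeroSet Y) \ A)
  have t4 := (O.contract A).eRk_ne_top ((O.zeroSet X ∩ O.zeroSet Y) \ A)
  clear e1 e2 e3 e4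
  generalize (O.contract A).toMatroid.eRk (O.zeroSet X \ A) = x at *
  generalize (O.contract A).toMatroid.eRk (O.zeroSet Y \ A) = y at *
  generalize (O.contract A).toMatroid.eRk ((O.zeroSet X ∪ O.zeroSet Y) \ A) = u at *
  generalize (O.contract A).toMatroid.eRk ((O.zeroSet X ∩ O.zeroSet Y) \ A) = v at *
  generalize O.toMatroid.eRk A = a at *
  lift a to ℕ using t0
  lift x to ℕ using t1
  lift y to ℕ using t2
  lift u to ℕ using t3
  lift v to ℕ using t4
  norm_cast at *
  omega

theorem mem_cocircuits_contract_iff {α : Type*} {O : OrientedMatroid α} {A : Set α}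
    {X : α → SignType} :
    X ∈ (O.contract A).cocircuits ↔ X ∈ O.cocircuits ∧ ∀ a ∈ A, X a = 0 := by
  constructor
  · rintro ⟨⟨hX, hXA⟩, hX0, hmin⟩
    refine ⟨⟨hX, hX0, fun V hV hV0 hs => hmin V ⟨hV, fun a ha => ?_⟩ hV0 hs⟩, hXA⟩
    by_contra h
    exact hs h (hXA a ha)
  · rintro ⟨⟨hX, hX0, hmin⟩, hXA⟩
    exact ⟨⟨hX, hXA⟩, hX0, fun V hV => hmin V hV.1⟩

end OrientedMatroid

/-! ### Passing between `O` and its lexicographic extension -/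

namespace OrientedMatroid

open Classical in
/-- The sign vector `X` with its entry at `p` deleted. -/
noncomputable def eraseAt {α : Type*} (p : α) (X : α → SignType) : α → SignType :=
  Function.update X p 0

@[simp]
theorem eraseAt_self {α : Type*} (p : α) (X : α → SignType) : eraseAt p X p = 0 := by
  simp [eraseAt]

theorem eraseAt_of_ne {α : Type*} {p a : α} (h : a ≠ p) (X : α → SignType) :
    eraseAt p X a = X a := by
  simp [eraseAt, h]

theorem eraseAt_eq_zero {α : Type*} {p a : α} {X : α → SignType} (h : X a = 0) :
    eraseAt p X a = 0 := by
  by_cases ha : a = p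
  · rw [ha, eraseAt_self]
  · rw [eraseAt_of_ne ha, h]

open Classical in
/-- The sign vector of the lexicographic extension by `p` that lies above `X`. -/
noncomputable def lexLift {α : Type*} (I : List α) (p : α) (X : α → SignType) : α → SignType :=
  Function.update X p (lexSign I X)

@[simp]
theorem lexLift_self {α : Type*} (I : List α) (p : α) (X : α → SignType) :
    lexLift I p X p = lexSign I X := by
  simp [lexLift]

theorem lexLift_of_ne {α : Type*} (I : List α) {p a : α} (h : a ≠ p) (X : α → SignType) :
    lexLift I p X a = X a := by
  simp [lexLift, h]

theorem lexSign_eq_getElem {α : Type*} {Y : α → SignType} : ∀ (I : List α) (i : ℕ)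
    (hi : i < I.length), (∀ e ∈ I.take i, Y e = 0) → Y I[i] ≠ 0 → lexSign I Y = Y I[i]
  | a :: I, 0, _, _, h => by
    simp only [List.getElem_cons_zero] at h ⊢
    simp [lexSign, h]
  | a :: I, i + 1, hi, h0, h => by
    have ha : Y a = 0 := h0 a (by simp)
    simp only [lexSign, ha, if_true, List.getElem_cons_succ] at h ⊢
    exact lexSign_eq_getElem I i (by simpa using hi) (fun e he => h0 e (by simp [he])) h

namespace IsPositiveLexExtension

variable {α : Type*} {O O' : OrientedMatroid α} {I : List α} {p : α}

theorem eraseAt_mem (hO' : O.IsPositiveLexExtension I p O') {W : α → SignType}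
    (hW : W ∈ O'.covectors) : eraseAt p W ∈ O.covectors := by
  rw [← hO'.deletion_eq]
  exact ⟨W, hW, rfl⟩

theorem lexLift_mem (hO' : O.IsPositiveLexExtension I p O') {V : α → SignType}
    (hV : V ∈ O.cocircuits) : lexLift I p V ∈ O'.cocircuits := hO'.localization V hV

/-- As `p` is not a coloop, a covector that vanishes everywhere else vanishes at `p` as well. -/
theorem eraseAt_ne_zero (hO' : O.IsPositiveLexExtension I p O') {W : α → SignType}
    (hW : W ∈ O'.covectors) (h0 : W ≠ 0) : eraseAt p W ≠ 0 := by
  intro h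
  have hz : ∀ a, a ≠ p → W a = 0 := fun a ha => by
    rw [← eraseAt_of_ne ha W, h]
    rfl
  have hpE : p ∈ O'.toMatroid.E := by
    rw [toMatroid_E, hO'.ground_eq]
    exact Set.mem_insert _ _
  have hcol := hO'.not_isColoop
  rw [Matroid.isColoop_iff_notMem_closure_compl hpE, not_not, toMatroid_E,
    mem_closure_iff _ Set.sdiff_subset hpE] at hcol
  refine h0 (funext fun a => ?_)
  by_cases ha : a = p
  · rw [ha]
    exact hcol W hW fun b hb => hz b hb.2
  · exact hz a ha

/-- Every cocircuit of the extension that is nonzero at `p` is a lift from `O`. The lift of a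
cocircuit of `O` supported in `eraseAt p W` is supported in `W`, because `W p ≠ 0` leaves room at
`p`; minimality of `W` then equates the supports. -/
theorem eraseAt_mem_cocircuits (hO' : O.IsPositiveLexExtension I p O') {W : α → SignType}
    (hW : W ∈ O'.cocircuits) (hp : W p ≠ 0) :
    eraseAt p W ∈ O.cocircuits ∧ lexSign I (eraseAt p W) = W p := by
  have hE := hO'.eraseAt_mem hW.1
  have hE0 := hO'.eraseAt_ne_zero hW.1 hW.2.1
  have hsup : ∀ V ∈ O.cocircuits, Function.support V ⊆ Function.support (eraseAt p W) →
      Function.support W ⊆ Function.support (lexLift I p V) := by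
    intro V hV hs
    have hL := hO'.lexLift_mem hV
    refine hW.2.2 _ hL.1 hL.2.1 fun a ha => ?_
    by_cases hap : a = p
    · rw [hap]
      exact hp
    · have := hs (show a ∈ Function.support V by
        rwa [Function.mem_support, lexLift_of_ne I hap] at ha)
      rwa [Function.mem_support, eraseAt_of_ne hap] at this
  have hmem : eraseAt p W ∈ O.cocircuits := by
    refine ⟨hE, hE0, fun V hV hV0 hs a ha => ?_⟩
    obtain ⟨V', hV', hs'⟩ := exists_cocircuit_of_ne_zero hV hV0
    have hap : a ≠ p := by
      rintro rfl
      simp at ha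
    rw [Function.mem_support, eraseAt_of_ne hap] at ha
    have := hsup V' hV' (hs'.trans hs) ha
    rw [Function.mem_support, lexLift_of_ne I hap] at this
    exact hs' this
  refine ⟨hmem, ?_⟩
  obtain ⟨d, hd⟩ := Function.ne_iff.1 hE0
  have hdp : d ≠ p := by
    rintro rfl
    simp at hd
  have := eq_of_mem_cocircuits (V := W) (hO'.lexLift_mem hmem) hW.1 (fun a ha => ?_) (d := d)
    (by rwa [lexLift_of_ne I hdp]) (by rw [lexLift_of_ne I hdp, eraseAt_of_ne hdp])
  · rw [← lexLift_self I p, ← this]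
  · by_contra hWa
    exact hsup _ hmem subset_rfl hWa ha

theorem indep_iff (hO' : O.IsPositiveLexExtension I p O') {J : Set α} (hJ : J ⊆ O.E) :
    O'.Indep J ↔ O.Indep J := by
  have hJp : ∀ a ∈ J, a ≠ p := fun a ha h => hO'.notMem (h ▸ hJ ha)
  constructor
  · rintro ⟨-, h⟩
    refine ⟨hJ, fun e he => ?_⟩
    obtain ⟨X, hX, hXe, hX'⟩ := h e he
    exact ⟨_, hO'.eraseAt_mem hX, by rwa [eraseAt_of_ne (hJp e he)],
      fun b hb hbe => eraseAt_eq_zero (hX' b hb hbe)⟩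
  · rintro ⟨-, h⟩
    refine ⟨hJ.trans (hO'.ground_eq ▸ Set.subset_insert _ _), fun e he => ?_⟩
    obtain ⟨X, hX, hXe, hX'⟩ := h e he
    rw [← hO'.deletion_eq] at hX
    obtain ⟨W, hW, rfl⟩ := hX
    change eraseAt p W e ≠ 0 at hXe
    change ∀ b ∈ J, b ≠ e → eraseAt p W b = 0 at hX'
    refine ⟨W, hW, by rwa [eraseAt_of_ne (hJp e he)] at hXe, fun b hb hbe => ?_⟩
    rw [← eraseAt_of_ne (hJp b hb) W]
    exact hX' b hb hbe

theorem eRk_eq (hO' : O.IsPositiveLexExtension I p O') {S : Set α} (hS : S ⊆ O.E) :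
    O'.toMatroid.eRk S = O.toMatroid.eRk S := by
  refine le_antisymm ?_ ?_
  · refine Matroid.eRk_le_iff.2 fun J hJS hJ => ?_
    exact Matroid.Indep.encard_le_eRk_of_subset
      ((toMatroid_indep_iff _ _).2 ((hO'.indep_iff (hJS.trans hS)).1 hJ)) hJS
  · refine Matroid.eRk_le_iff.2 fun J hJS hJ => ?_
    exact Matroid.Indep.encard_le_eRk_of_subset
      ((toMatroid_indep_iff _ _).2 ((hO'.indep_iff (hJS.trans hS)).2 hJ)) hJS

theorem zeroSet_eq (hO' : O.IsPositiveLexExtension I p O') {X : α → SignType} (hX : X p ≠ 0) :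
    O'.zeroSet X = O.zeroSet (eraseAt p X) := by
  ext a
  simp only [zeroSet, hO'.ground_eq, Set.mem_ofPred_eq, Set.mem_insert_iff]
  by_cases ha : a = p
  · subst ha
    simp [hX, hO'.notMem]
  · simp [ha, eraseAt_of_ne ha]

/-- When neither vector vanishes at `p`, the zero sets lie in the old ground set, where the
extension has the ranks of `O`. -/
theorem comodular_eraseAt (hO' : O.IsPositiveLexExtension I p O') {X Y : α → SignType}
    (h : O'.Comodular X Y) (hX : X p ≠ 0) (hY : Y p ≠ 0) :
    O.Comodular (eraseAt p X) (eraseAt p Y) := by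
  unfold Comodular at *
  rw [hO'.zeroSet_eq hX, hO'.zeroSet_eq hY, hO'.eRk_eq zeroSet_subset, hO'.eRk_eq zeroSet_subset,
    hO'.eRk_eq (Set.union_subset zeroSet_subset zeroSet_subset),
    hO'.eRk_eq (Set.inter_subset_left.trans zeroSet_subset)] at h
  exact h

theorem eq_zero_of_eraseAt {X Y V : α → SignType} (hV : ∀ a, X a = 0 → Y a = 0 → V a = 0)
    (a : α) (hX : eraseAt p X a = 0) (hY : eraseAt p Y a = 0) : eraseAt p V a = 0 := by
  by_cases ha : a = p
  · rw [ha, eraseAt_self]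
  · rw [eraseAt_of_ne ha] at *
    exact hV a hX hY

/-- In the coline of an edge of the cocircuit graph, a covector that vanishes at an old element
outside of the coline has the lexicographic sign at `p`. -/
theorem apply_eq_lexSign (hO' : O.IsPositiveLexExtension I p O') {X Y U : α → SignType} {d : α}
    (h : O'.IsEdge p X Y) (hU : U ∈ O'.covectors) (hU0 : U ≠ 0)
    (hF : ∀ a, X a = 0 → Y a = 0 → U a = 0) (hdp : d ≠ p) (hd : X d ≠ 0 ∨ Y d ≠ 0)
    (hUd : U d = 0) : U p = lexSign I (eraseAt p U) := by
  have hXp : X p ≠ 0 := by simp [h.1.2]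
  have hYp : Y p ≠ 0 := by simp [h.2.1.2]
  -- The coline criterion is applied in `O`, which is why the extra zero `d` must differ from `p`.
  have hc : eraseAt p U ∈ O.cocircuits :=
    (hO'.comodular_eraseAt h.2.2.2.1 hXp hYp).mem_cocircuits
      (hO'.eraseAt_mem_cocircuits h.1.1 hXp).1 (hO'.eraseAt_mem_cocircuits h.2.1.1 hYp).1
      (hO'.eraseAt_mem hU) (hO'.eraseAt_ne_zero hU hU0) (eq_zero_of_eraseAt hF)
      (e := d) (by simpa only [eraseAt_of_ne hdp] using hd) (eraseAt_eq_zero hUd)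
  have hL := hO'.lexLift_mem hc
  have hUc := h.2.2.2.1.mem_cocircuits h.1.1 h.2.1.1 hU hU0 hF hd hUd
  obtain ⟨b, hb⟩ := Function.ne_iff.1 hc.2.1
  have hbp : b ≠ p := by
    rintro rfl
    simp at hb
  have hUb : U b ≠ 0 := by rwa [eraseAt_of_ne hbp] at hb
  have hLF : ∀ a, X a = 0 → Y a = 0 → lexLift I p (eraseAt p U) a = 0 := fun a hX hY => by
    have hap : a ≠ p := fun h => hXp (h ▸ hX)
    rw [lexLift_of_ne I hap, eraseAt_of_ne hap, hF a hX hY]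
  have hLb : lexLift I p (eraseAt p U) b = U b := by
    rw [lexLift_of_ne I hbp, eraseAt_of_ne hbp]
  have hLd : lexLift I p (eraseAt p U) d = 0 := by
    rw [lexLift_of_ne I hdp, eraseAt_of_ne hdp, hUd]
  -- `U` and the lift of its erasure lie in the same coline, both vanish at `d` and agree at `b`, so
  -- they coincide.
  have := eq_of_mem_cocircuits hUc hL.1 (fun a ha => h.2.2.2.1.eq_zero h.1.1 h.2.1.1 hU hL.1 hU0 hF
    hLF hd hUd hLd ha) hUb hLb
  rw [← lexLift_self I p, this]

/-- Along an edge that leaves the hyperplane of the first relevant element of the list, the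
objective sign of the eliminating cocircuit is that of the start. -/
theorem elimination_apply_of_leaving (hO' : O.IsPositiveLexExtension I p O')
    (hIE : ∀ e ∈ I, e ∈ O.E) {X Y Z : α → SignType} {f : α} {i : ℕ} (hi : i < I.length)
    (h : O'.IsEdge p X Y) (hZ : O'.IsElimination p (-X) Y Z) (hfp : f ≠ p)
    (hXA : ∀ e ∈ I.take i, X e = 0) (hYA : ∀ e ∈ I.take i, Y e = 0) (hX : X I[i] = 0)
    (hY : Y I[i] ≠ 0) (hXf : X f ≠ 0) : Z f = -X f := by
  by_contra hne
  have hip : ∀ e ∈ I, e ≠ p := fun e he h => hO'.notMem (h ▸ hIE e he)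
  have hIi : I[i] ∈ I := List.getElem_mem hi
  have hsign : ∀ {V : α → SignType}, (∀ e ∈ I.take i, V e = 0) → V I[i] ≠ 0 →
      lexSign I (eraseAt p V) = V I[i] := fun {V} hVA hV => by
    rw [lexSign_eq_getElem I i hi (fun e he => eraseAt_eq_zero (hVA e he))] <;>
      rw [eraseAt_of_ne (hip _ hIi)]
    exact hV
  have hY1 : Y I[i] = 1 := by
    rw [← hsign hYA hY, (hO'.eraseAt_mem_cocircuits h.2.1.1 (by simp [h.2.1.2])).2, h.2.1.2]
  have hZi : Z I[i] = 1 := by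
    rw [h.isElimination_apply hZ fun h => h.1 (by simp [hX])]
    simp [signComp, hX, hY1]
  -- The rule to be broken: a zero at `f` makes the sign at `p` lexicographic, and here the first
  -- nonzero entry is the `+` at `I[i]`.
  have key : ∀ V ∈ O'.covectors, V f = 0 → (∀ a, X a = 0 → Y a = 0 → V a = 0) → V I[i] = 1 →
      V p = 1 := fun V hV hVf hF hVi => by
    rw [hO'.apply_eq_lexSign h hV (fun h0 => by simp [h0] at hVi) hF hfp (Or.inl hXf) hVf,
      hsign (fun e he => hF e (hXA e he) (hYA e he)) (by simp [hVi]), hVi]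
  by_cases hZf : Z f = 0
  · have := key Z hZ.1.1 hZf hZ.eq_zero hZi
    rw [hZ.2.1] at this
    exact absurd this (by decide)
  · have hsep : f ∈ signSep (-X) Z := by
      refine ⟨by simpa using hXf, ?_⟩
      revert hne hXf hZf
      simp only [Pi.neg_apply]
      generalize X f = x
      generalize Z f = z
      revert x z
      decide
    -- Since `X` vanishes at `I[i]` and `Z` at `p`, eliminating `f` keeps the `+` of `Z` at `I[i]`
    -- but inherits the `-` of `-X` at `p`.
    obtain ⟨V, hV, hVf, hV'⟩ := O'.elim (-X) (O'.neg_mem X h.1.1.1) Z hZ.1.1 f hsep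
    have := key V hV hVf (fun a hXa hYa => ?_) ?_
    · rw [hV' p ?_] at this
      · simp [signComp, h.1.2] at this
      · rintro ⟨h1, h2⟩
        rw [h2, hZ.2.1] at h1
        exact h1 neg_zero
    · have h1 : (-X) a = 0 := by simp [hXa]
      rw [hV' a fun h => h.1 h1]
      simp [signComp, hXa, hZ.eq_zero a hXa hYa]
    · have h1 : (-X) I[i] = 0 := by simp [hX]
      rw [hV' _ fun h => h.1 h1]
      simp [signComp, hX, hZi]

/-- In general position, the objective does not vanish on the cocircuits of a coline outside of
the objective that vanish on a further element. -/
theorem _root_.OrientedMatroid.InGeneralPosition.apply_ne_zero {f e : α}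
    (hf : O.InGeneralPosition f) {X Y W : α → SignType} (hX : X ∈ O.cocircuits)
    (hY : Y ∈ O.cocircuits) (h : O.Comodular X Y) (hW : W ∈ O.covectors) (hW0 : W ≠ 0)
    (hF : ∀ a, X a = 0 → Y a = 0 → W a = 0) (hfF : X f ≠ 0 ∨ Y f ≠ 0) (hef : f ≠ e)
    (he : X e ≠ 0 ∨ Y e ≠ 0) (hWe : W e = 0) : W f ≠ 0 := by
  intro hWf
  have heE : e ∈ O.E := he.elim (mem_ground_of_ne_zero hX.1) (mem_ground_of_ne_zero hY.1)
  set A := insert e (O.zeroSet X ∩ O.zeroSet Y) with hA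
  have hAE : A ⊆ O.E := Set.insert_subset heE (Set.inter_subset_left.trans zeroSet_subset)
  have hAf : A ⊆ O.E \ {f} := by
    refine fun a ha => ⟨hAE ha, ?_⟩
    rintro rfl
    rcases ha with ha | ha
    · exact hef ha
    · exact hfF.elim (fun h => h ha.1.2) (fun h => h ha.2.2)
  have hWA : ∀ a ∈ A, W a = 0 := by
    rintro a (rfl | ha)
    · exact hWe
    · exact hF a ha.1.2 ha.2.2
  -- If `W f = 0`, every covector vanishing on `A` vanishes at `f`. General position makes `A`
  -- spanning, which is impossible because `W` is nonzero and vanishes on `A`.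
  have hcl : f ∈ O.toMatroid.closure A := by
    refine (O.mem_closure_iff hAE hf.1).2 fun V hV hVA => ?_
    refine h.eq_zero hX hY hW hV hW0 hF (fun a h1 h2 => ?_) he hWe (hVA e (Set.mem_insert _ _)) hWf
    by_cases ha : a ∈ O.E
    · exact hVA a (Set.mem_insert_of_mem _ ⟨⟨ha, h1⟩, ⟨ha, h2⟩⟩)
    · exact O.eq_zero_of_notMem V hV a ha
  have hsp := (hf.2 A hAf hcl).closure_eq
  refine hW0 (funext fun a => ?_)
  by_contra ha
  have haE := mem_ground_of_ne_zero hW ha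
  refine ha ((O.mem_closure_iff hAE haE).1 ?_ W hW hWA)
  rw [hsp]
  exact haE

/-- Distinctness survives because both vertices have `+` at `p` and so differ elsewhere;
comodularity survives first the erasure of `p`, then the contraction. -/
theorem isEdge_contract (hO' : O.IsPositiveLexExtension I p O')
    (hIE : O.Indep {e | e ∈ I}) {X Y : α → SignType} {i : ℕ} (hi : i < I.length)
    (h : O'.IsEdge p X Y) (hXA : ∀ e ∈ I.take i, X e = 0) (hYA : ∀ e ∈ I.take i, Y e = 0)
    (hX : X I[i] = 1) (hY : Y I[i] = 1) :
    (O.contract {e | e ∈ I.take i}).IsEdge I[i] (eraseAt p X) (eraseAt p Y) := by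
  have hip : I[i] ≠ p := fun h => hO'.notMem (h ▸ hIE.1 (List.getElem_mem hi))
  have hXp : X p ≠ 0 := by simp [h.1.2]
  have hYp : Y p ≠ 0 := by simp [h.2.1.2]
  have hXA' : ∀ e ∈ {e | e ∈ I.take i}, eraseAt p X e = 0 := fun e he => eraseAt_eq_zero (hXA e he)
  have hYA' : ∀ e ∈ {e | e ∈ I.take i}, eraseAt p Y e = 0 := fun e he => eraseAt_eq_zero (hYA e he)
  refine ⟨⟨mem_cocircuits_contract_iff.2 ⟨(hO'.eraseAt_mem_cocircuits h.1.1 hXp).1, hXA'⟩,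
      by rw [eraseAt_of_ne hip, hX]⟩,
    ⟨mem_cocircuits_contract_iff.2 ⟨(hO'.eraseAt_mem_cocircuits h.2.1.1 hYp).1, hYA'⟩,
      by rw [eraseAt_of_ne hip, hY]⟩, fun heq => h.2.2.1 (funext fun a => ?_),
    (hO'.comodular_eraseAt h.2.2.2.1 hXp hYp).contract
      (hIE.mono fun e he => List.mem_of_mem_take he) hXA' hYA',
    Set.eq_empty_of_forall_notMem fun a ha => ?_⟩
  · by_cases ha : a = p
    · rw [ha, h.1.2, h.2.1.2]
    · rw [← eraseAt_of_ne ha X, heq, eraseAt_of_ne ha]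
  · have hap : a ≠ p := by
      rintro rfl
      exact ha.1 (eraseAt_self _ _)
    have : a ∈ signSep X Y := by
      simpa only [signSep, Set.mem_ofPred_eq, eraseAt_of_ne hap] using ha
    rw [h.2.2.2.2] at this
    exact this

/-- Along an edge off the hyperplane of the first relevant element of the list, eliminating `p`
and eliminating that element yield the same objective sign. -/
theorem elimination_apply_eq (hO' : O.IsPositiveLexExtension I p O')
    (hIE : O.Indep {e | e ∈ I}) {f : α} (hf : O.InGeneralPosition f) (hfI : f ∉ I)
    {X Y Z W : α → SignType} {i : ℕ} (hi : i < I.length)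
    (h : O'.IsEdge p X Y) (hXA : ∀ e ∈ I.take i, X e = 0) (hYA : ∀ e ∈ I.take i, Y e = 0)
    (hX : X I[i] = 1) (hY : Y I[i] = 1) (hZ : O'.IsElimination p (-X) Y Z)
    (hW : (O.contract {e | e ∈ I.take i}).IsElimination I[i] (-eraseAt p X) (eraseAt p Y) W)
    (hXf : X f ≠ 0) : Z f = W f := by
  by_contra hne
  have hip : I[i] ≠ p := fun h => hO'.notMem (h ▸ hIE.1 (List.getElem_mem hi))
  have hfp : f ≠ p := fun h => hO'.notMem (h ▸ hf.1)
  have hXp : X p ≠ 0 := by simp [h.1.2]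
  have hYp : Y p ≠ 0 := by simp [h.2.1.2]
  have hXi : X I[i] ≠ 0 := by simp [hX]
  have hE := hO'.isEdge_contract hIE hi h hXA hYA hX hY
  have hWc : W ∈ O.cocircuits := (mem_cocircuits_contract_iff.1 hW.1).1
  have hL := hO'.lexLift_mem hWc
  set W' := lexLift I p W with hW'
  have hLF : ∀ a, X a = 0 → Y a = 0 → W' a = 0 := fun a h1 h2 => by
    have hap : a ≠ p := fun h => hXp (h ▸ h1)
    rw [hW', lexLift_of_ne I hap]
    exact hW.eq_zero a (eraseAt_eq_zero h1) (eraseAt_eq_zero h2)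
  have hLi : W' I[i] = 0 := by rw [hW', lexLift_of_ne I hip, hW.2.1]
  have hLf : W' f = W f := by rw [hW', lexLift_of_ne I hfp]
  have hLp : W' p = lexSign I W := lexLift_self I p W
  obtain ⟨d, hd, hd0, -, hdF, hdne⟩ := h.exists_ne
  have hdp : d ≠ p := by
    rintro rfl
    exact hdne (by rw [h.1.2, h.2.1.2])
  have hZd : Z d = signComp (-X) Y d := h.isElimination_apply hZ hd
  have hLd : W' d = Z d := by
    rw [hZd, hW', lexLift_of_ne I hdp, hE.isElimination_apply hW]
    · simp only [signComp, Pi.neg_apply, eraseAt_of_ne hdp]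
    · simpa only [signSep, Set.mem_ofPred_eq, Pi.neg_apply, eraseAt_of_ne hdp] using hd
  have hZd0 : Z d ≠ 0 := by rwa [hZd]
  -- `Z` and `W'` agree at `d`. A common zero outside the coline would make them equal, contrary to
  -- the assumed difference at `f`; hence `W' p` and `Z I[i]` are nonzero.
  have noshared : ∀ e, X e ≠ 0 → Z e = 0 → W' e ≠ 0 := fun e he hZe hLe => by
    have := eq_of_mem_cocircuits hZ.1 hL.1 (fun a ha => h.2.2.2.1.eq_zero h.1.1 h.2.1.1 hZ.1.1
      hL.1 hZ.1.2.1 hZ.eq_zero hLF (Or.inl he) hZe hLe ha) hZd0 hLd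
    exact hne (by rw [← hLf, this])
  have hs : W' p ≠ 0 := noshared p hXp hZ.2.1
  have ht : Z I[i] ≠ 0 := fun h => noshared _ hXi h hLi
  have key : ∀ U ∈ O'.covectors, (∀ a, X a = 0 → Y a = 0 → U a = 0) → U I[i] = Z I[i] →
      ∀ b, b ≠ p → (X b ≠ 0 ∨ Y b ≠ 0) → U b = 0 → U p = Z I[i] := by
    intro U hU hF hUi b hbp hb hUb
    have hU0 : U I[i] ≠ 0 := by rwa [hUi]
    rw [hO'.apply_eq_lexSign h hU (fun h0 => hU0 (by simp [h0])) hF hbp hb hUb,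
      lexSign_eq_getElem I i hi
        (fun e he => eraseAt_eq_zero (hF e (hXA e he) (hYA e he))), eraseAt_of_ne hip, hUi]
    rwa [eraseAt_of_ne hip]
  have elimF : ∀ {V₁ V₂ U : α → SignType}, (∀ a, X a = 0 → Y a = 0 → V₁ a = 0) →
      (∀ a, X a = 0 → Y a = 0 → V₂ a = 0) →
      (∀ a, a ∉ signSep V₁ V₂ → U a = signComp V₁ V₂ a) →
      ∀ a, X a = 0 → Y a = 0 → U a = 0 := fun h1 h2 hU a hXa hYa => by
    rw [hU a fun h => h.1 (h1 a hXa hYa)]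
    simp [signComp, h1 a hXa hYa, h2 a hXa hYa]
  by_cases hts : Z I[i] = W' p
  -- Eliminating `d` between `Z` and `-W'` keeps `Z I[i]` and puts `-W' p` at `p`, whereas the
  -- lexicographic rule demands `Z I[i] = W' p`.
  · obtain ⟨U, hU, hUd, hU'⟩ := O'.elim Z hZ.1.1 (-W') (O'.neg_mem _ hL.1) d
      ⟨hZd0, by simp [hLd]⟩
    have h2 : ∀ a, X a = 0 → Y a = 0 → (-W') a = 0 := fun a h1 h2 => by simp [hLF a h1 h2]
    have := key U hU (elimF hZ.eq_zero h2 hU') ?_ d hdp hdF hUd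
    · rw [hU' p fun h => h.1 hZ.2.1, hts] at this
      simp only [signComp, hZ.2.1, if_true, Pi.neg_apply] at this
      revert hs this
      generalize W' p = x
      revert x
      decide
    · rw [hU' _ fun h => ht (by rw [h.2]; simp [hLi])]
      simp [signComp, ht]
  -- The signs `Z I[i]` and `W' p` now differ, so `f` is eliminated between `Z` and `W'` instead.
  -- General position makes `W' f` nonzero; a zero of `Z` at `f` breaks the rule directly.
  · have hWf : W' f ≠ 0 := by
      rw [hLf]
      refine hf.apply_ne_zero (hO'.eraseAt_mem_cocircuits h.1.1 hXp).1
        (hO'.eraseAt_mem_cocircuits h.2.1.1 hYp).1 (hO'.comodular_eraseAt h.2.2.2.1 hXp hYp)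
        hWc.1 hWc.2.1 hW.eq_zero (e := I[i]) (Or.inl (by rwa [eraseAt_of_ne hfp]))
        (fun h => hfI (h ▸ List.getElem_mem hi)) (Or.inl (by rwa [eraseAt_of_ne hip])) hW.2.1
    by_cases hZf : Z f = 0
    · have := key Z hZ.1.1 hZ.eq_zero rfl f hfp (Or.inl hXf) hZf
      exact ht (by rw [← this, hZ.2.1])
    · obtain ⟨V, hV, hVf, hV'⟩ := O'.elim Z hZ.1.1 W' hL.1 f
        ⟨hZf, sign_sep hZf hWf (by rwa [hLf])⟩
      have := key V hV (elimF hZ.eq_zero hLF hV') ?_ f hfp (Or.inl hXf) hVf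
      · rw [hV' p fun h => h.1 hZ.2.1] at this
        simp only [signComp, hZ.2.1, if_true] at this
        exact hts this.symm
      · rw [hV' _ fun h => ht (by rw [h.2]; simp [hLi])]
        simp [signComp, ht]

end IsPositiveLexExtension

end OrientedMatroid

/-! ### Monotone signs on closed paths, and the transfer of cycles -/

theorem List.IsChain.eq_of_head?_eq_getLast? {β γ : Type*} [PartialOrder β] {m : γ → β}
    {P : List γ} (hP : P.IsChain (fun x y => m x ≤ m y)) (h : P.head? = P.getLast?) {x y : γ}
    (hx : x ∈ P) (hy : y ∈ P) : m x = m y := by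
  have hpair : (P.map m).Pairwise (· ≤ ·) :=
    List.isChain_iff_pairwise.1 ((List.isChain_map m).2 hP)
  have hle : ∀ (i j : ℕ) (hij : i ≤ j) (hj : j < P.length), m P[i] ≤ m P[j] := by
    intro i j hij hj
    rcases hij.eq_or_lt with rfl | hij
    · exact le_rfl
    · have := List.pairwise_iff_getElem.1 hpair i j (by simp; omega) (by simpa using hj) hij
      simpa using this
  have hpos : 0 < P.length := List.length_pos_of_mem hx
  have hends : P[0] = P[P.length - 1] := by
    rw [List.head?_eq_getElem?, List.getLast?_eq_getElem?, List.getElem?_eq_getElem hpos,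
      List.getElem?_eq_getElem (by omega)] at h
    exact Option.some.inj h
  have hfirst : ∀ z ∈ P, m z = m P[0] := by
    intro z hz
    obtain ⟨i, hi, rfl⟩ := List.getElem_of_mem hz
    refine le_antisymm ?_ (hle 0 i (Nat.zero_le i) hi)
    rw [hends]
    exact hle i _ (by omega) (by omega)
  rw [hfirst x hx, hfirst y hy]

namespace OrientedMatroid

/-- Take a covector of minimal support among those nonzero at `e`. A smaller nonzero covector would
have to vanish at `e`, and `exchange` would use it to shrink the support while keeping `e`. -/
theorem exists_cocircuit_apply_ne_zero {α : Type*} {O : OrientedMatroid α} {X : α → SignType}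
    {e : α} (hX : X ∈ O.covectors) (he : X e ≠ 0) : ∃ V ∈ O.cocircuits, V e ≠ 0 := by
  have hfin : {S : Set α | ∃ V ∈ O.covectors, V e ≠ 0 ∧ Function.support V = S}.Finite :=
    O.finite.finite_subsets.subset (by
      rintro _ ⟨V, hV, -, rfl⟩ a ha
      exact mem_ground_of_ne_zero hV ha)
  obtain ⟨S, -, hS⟩ := hfin.exists_le_minimal ⟨X, hX, he, rfl⟩
  obtain ⟨⟨V, hV, hVe, rfl⟩, hmin⟩ := hS
  refine ⟨V, ⟨hV, fun h => hVe (by simp [h]), fun W hW hW0 hs => ?_⟩, hVe⟩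
  by_cases hWe : W e = 0
  · obtain ⟨b, hb⟩ := Function.ne_iff.1 hW0
    obtain ⟨Z, hZ, hZA, hZb, hZe⟩ := exchange (A := {a | V a = 0}) (e := b) hW
      (fun a ha => by
        by_contra h
        exact hs h ha) hWe hb hV (fun a ha => ha) hVe
    have hZV : Function.support Z ⊆ Function.support V := fun a ha h => ha (hZA a h)
    exact absurd hZb (hmin ⟨Z, hZ, hZe, rfl⟩ hZV (hs hb))
  · exact hmin ⟨W, hW, hWe, rfl⟩ hs

theorem IsPositiveLexExtension.isProgram {α : Type*} {O O' : OrientedMatroid α} {I : List α}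
    {p f : α} (hO' : O.IsPositiveLexExtension I p O') (hne : I ≠ [])
    (hI : O.Indep {e | e ∈ I}) (hfE : f ∈ O.E) (hf : ¬ O.toMatroid.IsColoop f) :
    O'.IsProgram p f := by
  have hsub : O.E ⊆ O'.E := hO'.ground_eq ▸ Set.subset_insert _ _
  have hpE : p ∈ O'.E := hO'.ground_eq ▸ Set.mem_insert _ _
  refine ⟨hpE, hsub hfE, fun h => hO'.notMem (h ▸ hfE), ?_, ?_⟩
  · intro hloop
    obtain ⟨e, he⟩ := List.exists_mem_of_ne_nil I hne
    obtain ⟨X, hX, hXe, -⟩ := hI.2 e he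
    obtain ⟨V, hV, hVe⟩ := exists_cocircuit_apply_ne_zero hX hXe
    have hp : p ∈ O'.toMatroid.closure ∅ := hloop
    have := (O'.mem_closure_iff (Set.empty_subset _) hpE).1 hp _ (hO'.lexLift_mem hV).1 (by simp)
    rw [lexLift_self] at this
    exact hVe ((lexSign_eq_zero_iff _ _).1 this e he)
  · rw [Matroid.isColoop_iff_notMem_closure_compl (hsub hfE), not_not, toMatroid_E,
      mem_closure_iff _ Set.sdiff_subset (hsub hfE)]
    rw [Matroid.isColoop_iff_notMem_closure_compl hfE, not_not, toMatroid_E,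
      mem_closure_iff _ Set.sdiff_subset hfE] at hf
    intro W hW hW0
    rw [← eraseAt_of_ne (p := p) (fun h => hO'.notMem (h ▸ hfE)) W]
    exact hf _ (hO'.eraseAt_mem hW) fun a ha => eraseAt_eq_zero (hW0 a ⟨hsub ha.1, ha.2⟩)

/-- By uniqueness of the elimination, the orientation of an edge can be read off from any one
eliminating cocircuit. -/
theorem IsEdge.directed_or_undirected_iff {α : Type*} {O : OrientedMatroid α} {g f : α}
    {X Y Z : α → SignType} (h : O.IsEdge g X Y) (hZ : O.IsElimination g (-X) Y Z) :
    (O.Directed g f X Y ∨ O.Undirected g f X Y) ↔ 0 ≤ Z f := by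
  have hs : ∀ s : SignType, 0 ≤ s ↔ s = 1 ∨ s = 0 := by decide
  rw [hs]
  constructor
  · rintro (⟨W, hW, hWf⟩ | ⟨W, hW, hWf⟩)
    · exact Or.inl (h.isElimination_unique hZ hW ▸ hWf)
    · exact Or.inr (h.isElimination_unique hZ hW ▸ hWf)
  · rintro (h | h)
    · exact Or.inl ⟨Z, hZ, h⟩
    · exact Or.inr ⟨Z, hZ, h⟩

theorem IsEdge.undirected_iff {α : Type*} {O : OrientedMatroid α} {g f : α}
    {X Y Z : α → SignType} (h : O.IsEdge g X Y) (hZ : O.IsElimination g (-X) Y Z) :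
    O.Undirected g f X Y ↔ Z f = 0 :=
  ⟨fun ⟨_, hW, hWf⟩ => h.isElimination_unique hZ hW ▸ hWf, fun h => ⟨Z, hZ, h⟩⟩

/-- On a directed cycle, the objective is constant and does not vanish. -/
theorem IsCycle.objective_ne_zero {α : Type*} {O : OrientedMatroid α} {g f : α}
    {P : List (α → SignType)} (hP : O.IsCycle g P) (hD : O.IsDirectedPath g f P) :
    ∃ c : SignType, c ≠ 0 ∧ ∀ X ∈ P, X f = c := by
  obtain ⟨⟨hne, hV, hE⟩, hends, -⟩ := hP
  obtain ⟨-, hU, hD⟩ := hD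
  obtain ⟨X₀, hX₀⟩ := List.exists_mem_of_ne_nil P hne
  have hconst : ∀ X ∈ P, X f = X₀ f := by
    intro X hX
    refine List.IsChain.eq_of_head?_eq_getLast? (m := fun X : α → SignType => X f) ?_ hends hX hX₀
    rw [List.isChain_iff_getElem] at *
    intro i hi
    obtain ⟨Z, hZ, -⟩ := (hE i hi).exists_isElimination
    exact (hE i hi).le_of_isElimination hZ (((hE i hi).directed_or_undirected_iff hZ).1 (hD i hi))
  -- If the constant were zero, each eliminating cocircuit would vanish at `f` along with both
  -- endpoints, and the path would be undirected.
  refine ⟨X₀ f, fun h0 => hU ⟨⟨hne, hV, hE⟩, ?_⟩, hconst⟩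
  rw [List.isChain_iff_getElem] at *
  intro i hi
  obtain ⟨Z, hZ, -⟩ := (hE i hi).exists_isElimination
  refine ⟨Z, hZ, hZ.eq_zero f ?_ ?_⟩
  · rw [hconst _ (List.getElem_mem _), h0]
  · rw [hconst _ (List.getElem_mem _), h0]

end OrientedMatroid

open OrientedMatroid in
theorem mainTheorem5 {α : Type*} (O : OrientedMatroid α) (f : α) (hf : O.InGeneralPosition f)
    (I : List α) (hne : I ≠ []) (hnodup : I.Nodup) (hI : O.toMatroid.Indep {e | e ∈ I})
    (hfI : f ∉ I)
    (hEucl : ∀ (i : ℕ) (hi : i < I.length),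
      (O.contract {e | e ∈ I.take i}).IsEuclideanProgram I[i] f)
    (p : α) (O' : OrientedMatroid α) (hO' : O.IsPositiveLexExtension I p O') :
    O'.IsEuclideanProgram p f := by
  have hII : O.Indep {e | e ∈ I} := hI
  have hIE : ∀ e ∈ I, e ∈ O.E := fun e he => hII.1 he
  have hfp : f ≠ p := fun h => hO'.notMem (h ▸ hf.1)
  refine ⟨hO'.isProgram hne hII hf.1 ?_, ?_⟩
  -- The program with index `0` is a contraction by the empty set, so it says that `f` is not a
  -- coloop of `O`.
  · have h0 := (hEucl 0 (List.length_pos_iff.2 hne)).1.2.2.2.2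
    rw [toMatroid_contract (A := {e | e ∈ I.take 0}) (hII.mono fun e he =>
        List.mem_of_mem_take he),
      Matroid.contract_isColoop_iff] at h0
    simpa using h0
  rintro ⟨P, hP, hD⟩
  obtain ⟨c, hc, hPc⟩ := hP.objective_ne_zero hD
  obtain ⟨⟨hPne, hV, hE⟩, hends, hnd⟩ := hP
  obtain ⟨-, hU, hD⟩ := hD
  have hex : ∃ i, ∃ hi : i < I.length, ∃ X ∈ P, X I[i] ≠ 0 := by
    obtain ⟨X, hX⟩ := List.exists_mem_of_ne_nil P hPne
    have hXp : X p ≠ 0 := by simp [(hV X hX).2]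
    have hs := (hO'.eraseAt_mem_cocircuits (hV X hX).1 hXp).2
    by_contra! hcon
    refine hXp ?_
    rw [← hs, lexSign_eq_zero_iff]
    intro e he
    obtain ⟨i, hi, rfl⟩ := List.getElem_of_mem he
    exact eraseAt_eq_zero (hcon i hi X hX)
  classical
  obtain ⟨hi, X₀, hX₀, hX₀i⟩ := Nat.find_spec hex
  have hmin : ∀ X ∈ P, ∀ e ∈ I.take (Nat.find hex), X e = 0 := by
    intro X hX e he
    obtain ⟨j, hj, rfl⟩ := List.getElem_of_mem he
    rw [List.length_take] at hj
    have := Nat.find_min hex (m := j) (by omega)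
    push Not at this
    rw [List.getElem_take]
    exact this (by omega) X hX
  generalize Nat.find hex = i at hi hX₀i hmin
  have hip : I[i] ≠ p := fun h => hO'.notMem (h ▸ hIE _ (List.getElem_mem hi))
  have hone : ∀ X ∈ P, X I[i] ≠ 0 → X I[i] = 1 := by
    intro X hX hXi
    have hs := (hO'.eraseAt_mem_cocircuits (hV X hX).1 (by simp [(hV X hX).2])).2
    rwa [(hV X hX).2, lexSign_eq_getElem I i hi (fun e he => eraseAt_eq_zero (hmin X hX e he)),
      eraseAt_of_ne hip] at hs
    rwa [eraseAt_of_ne hip]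
  rw [List.isChain_iff_getElem] at hE hD
  have hall : ∀ X ∈ P, X I[i] = 1 := by
    intro X hX
    rw [← hone X₀ hX₀ hX₀i]
    have h01 : ∀ X ∈ P, X I[i] = 0 ∨ X I[i] = 1 := fun X hX => or_iff_not_imp_left.2 (hone X hX)
    rcases eq_or_ne c 1 with hc1 | hc1
    -- For `c = 1`, an edge from `0` to `+` at `I[i]` would be directed backwards, so the sign at
    -- `I[i]` never increases; hence the dual order.
    · refine List.IsChain.eq_of_head?_eq_getLast?
        (m := fun X : α → SignType => OrderDual.toDual (X I[i])) ?_ hends hX hX₀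
      rw [List.isChain_iff_getElem]
      intro j hj
      obtain ⟨Z, hZ, -⟩ := (hE j hj).exists_isElimination
      have hZf := ((hE j hj).directed_or_undirected_iff hZ).1 (hD j hj)
      rw [OrderDual.toDual_le_toDual]
      rcases h01 _ (List.getElem_mem (Nat.lt_of_succ_lt hj)) with h0 | h0
      · by_contra hlt
        have := hO'.elimination_apply_of_leaving hIE hi (hE j hj) hZ hfp
          (hmin _ (List.getElem_mem _)) (hmin _ (List.getElem_mem _)) h0
          (fun h => hlt (by rw [h, h0])) (by rwa [hPc _ (List.getElem_mem _)])
        rw [this, hPc _ (List.getElem_mem _), hc1] at hZf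
        exact absurd hZf (by decide)
      · rw [h0]
        exact SignType.le_one _
    -- For `c = -1`, the same lemma applied to the reversed edge excludes steps from `+` to `0`, so
    -- the sign never decreases.
    · refine List.IsChain.eq_of_head?_eq_getLast?
        (m := fun X : α → SignType => X I[i]) ?_ hends hX hX₀
      rw [List.isChain_iff_getElem]
      intro j hj
      obtain ⟨Z, hZ, -⟩ := (hE j hj).exists_isElimination
      have hZf := ((hE j hj).directed_or_undirected_iff hZ).1 (hD j hj)
      rcases h01 _ (List.getElem_mem hj) with h0 | h0
      · by_contra hlt
        have := hO'.elimination_apply_of_leaving hIE hi (hE j hj).symm hZ.symm_neg hfp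
          (hmin _ (List.getElem_mem _)) (hmin _ (List.getElem_mem _)) h0
          (fun h => hlt (by rw [h, h0])) (by rwa [hPc _ (List.getElem_mem _)])
        rw [hPc _ (List.getElem_mem _), Pi.neg_apply, neg_inj] at this
        rw [this] at hZf
        revert hc hc1 hZf
        clear * -
        revert c
        decide
      · simp only [h0]
        exact SignType.le_one _
  set A : Set α := {e | e ∈ I.take i} with hA
  have hE' : ∀ (j : ℕ) (hj : j + 1 < P.length),
      (O.contract A).IsEdge I[i] (eraseAt p P[j]) (eraseAt p P[j + 1]) := fun j hj =>
    hO'.isEdge_contract hII hi (hE j hj) (hmin _ (List.getElem_mem _))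
      (hmin _ (List.getElem_mem _)) (hall _ (List.getElem_mem _)) (hall _ (List.getElem_mem _))
  have hcomp : ∀ (j : ℕ) (hj : j + 1 < P.length), ∃ Z W,
      O'.IsElimination p (-P[j]) P[j + 1] Z ∧
      (O.contract A).IsElimination I[i] (-eraseAt p P[j]) (eraseAt p P[j + 1]) W ∧
      Z f = W f := by
    intro j hj
    obtain ⟨Z, hZ, -⟩ := (hE j hj).exists_isElimination
    obtain ⟨W, hW, -⟩ := (hE' j hj).exists_isElimination
    exact ⟨Z, W, hZ, hW, hO'.elimination_apply_eq hII hf hfI hi (hE j hj)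
      (hmin _ (List.getElem_mem _)) (hmin _ (List.getElem_mem _)) (hall _ (List.getElem_mem _))
      (hall _ (List.getElem_mem _)) hZ hW (by rwa [hPc _ (List.getElem_mem _)])⟩
  -- All vertices carry `+` at `p`, so erasing that entry identifies no two of them.
  have hinj : ∀ X ∈ P, ∀ Y ∈ P, eraseAt p X = eraseAt p Y → X = Y := by
    intro X hX Y hY h
    funext a
    by_cases ha : a = p
    · rw [ha, (hV X hX).2, (hV Y hY).2]
    · rw [← eraseAt_of_ne ha X, h, eraseAt_of_ne ha]
  have hpath : (O.contract A).IsPath I[i] (P.map (eraseAt p)) := by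
    refine ⟨by simpa using hPne, ?_, ?_⟩
    · intro Y hY
      obtain ⟨X, hX, rfl⟩ := List.mem_map.1 hY
      exact ⟨mem_cocircuits_contract_iff.2 ⟨(hO'.eraseAt_mem_cocircuits (hV X hX).1
        (by simp [(hV X hX).2])).1, fun e he => eraseAt_eq_zero (hmin X hX e he)⟩,
        by rw [eraseAt_of_ne hip, hall X hX]⟩
    · rw [List.isChain_map, List.isChain_iff_getElem]
      exact hE'
  refine (hEucl i hi).2 ⟨P.map (eraseAt p), ⟨hpath, ?_, ?_⟩, hpath, ?_, ?_⟩
  · rw [List.head?_map, List.getLast?_map, hends]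
  · rw [← List.map_dropLast]
    exact hnd.map_on fun X hX Y hY => hinj X (List.mem_of_mem_dropLast hX) Y
      (List.mem_of_mem_dropLast hY)
  · rintro ⟨-, hund⟩
    rw [List.isChain_map, List.isChain_iff_getElem] at hund
    refine hU ⟨⟨hPne, hV, List.isChain_iff_getElem.2 hE⟩, List.isChain_iff_getElem.2 ?_⟩
    intro j hj
    obtain ⟨Z, W, hZ, hW, hZW⟩ := hcomp j hj
    refine ((hE j hj).undirected_iff hZ).2 ?_
    rw [hZW]
    exact ((hE' j hj).undirected_iff hW).1 (hund j hj)
  · rw [List.isChain_map, List.isChain_iff_getElem]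
    intro j hj
    obtain ⟨Z, W, hZ, hW, hZW⟩ := hcomp j hj
    refine ((hE' j hj).directed_or_undirected_iff hW).2 ?_
    rw [← hZW]
    exact ((hE j hj).directed_or_undirected_iff hZ).1 (hD j hj)
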